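/- Let $M$ be a smooth manifold (finite-dimensional, Hausdorff, second countable), $S\subset M$ a closed subset, and $I_S\subset C^\infty(M)$ the ideal of functions vanishing on $S$. Vector fields are identified with derivations of $C^\infty(M)$, and $n$-forms with alternating $C^\infty(M)$-multilinear maps $\mathfrak X(M)^n\to C^\infty(M)$, with $d$ the Chevalley--Eilenberg differential, $\iota_X$ insertion into the first slot and $\mathcal L_X=\iota_Xd+d\iota_X$. For the constraint algebra $A=(C^\infty(M),C^\infty(M),I_S)$ put $$\mathfrak X(A)_W=\{X\mid X(I_S)\subset I_S\},\qquad \mathfrak X(A)_0=\{X\mid X(C^\infty(M))\subset I_S\},$$ $$B_0^n=\{\alpha\in\Omega^n(M)\mid \alpha(v_1,\dots,v_n)\in I_S\ \ \forall v_i\in\mathfrak X(A)_W\},\qquad B_W^n=\{\alpha\in\Omega^n(M)\mid \iota_w\alpha\in B_0\ \ \forall w\in\mathfrak X(A)_0\},$$ so that $B_0=\mathrm{CE}(\mathfrak X(A))_0$ and $B_W=\mathrm{CE}(\mathfrak X(A))_W$. Let $F\subset\mathfrak X(A)_W$ be a Lie subalgebra, let $k\ge 1$, and let $\omega\in\Omega^{k+1}(M)$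 be closed with $\omega(F,\mathfrak X(A)_W,\dots,\mathfrak X(A)_W)|_S=0$. Let $\mathcal F$ be the smallest $C^\infty(M)$-submodule of $\mathfrak X(M)$ that is closed under the Lie bracket and contains $F$ and $\mathfrak X(A)_0$. Put $$\mathfrak Y_W=\{X\in\mathfrak X(A)_W\mid[\mathcal F,X]\subset\mathcal F\},\qquad B'_W=\{\alpha\in B_W\mid \iota_\xi\alpha,\ \mathcal L_\xi\alpha\in B_0\ \ \forall\xi\in\mathcal F\},\qquad B'_0=B_0 .$$ The observables $\mathrm{Ham}(M,\omega)$ consist of $\mathrm{Ham}^0=\{(\alpha,X)\in\Omega^{k-1}(M)\oplus\mathfrak X(M)\mid\iota_X\omega=-d\alpha\}$ in degree $0$ and $\mathrm{Ham}^{i}=\Omega^{k-1+i}(M)$ in degrees $i=-1,\dots,-(k-1)$, with the brackets $l_1=d$ in degrees $i<-1$, $l_1(\alpha)=(d\alpha,0)$ for $i=-1$, $l_1=0$ for $i=0$, $$l_2\big((\alpha,X),(\beta,Y)\big)=(-\iota_X\iota_Y\omega,[X,Y]),\qquad l_j\big((\alpha_1,X_1),\dots,(\alpha_j,X_j)\big)=(-1)^{j+1}\iota_{X_1}\cdots\iota_{X_j}\omega\quad(j\ge3),$$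 where $l_j$, $j\ge2$, vanishes if some argument has nonzero degree. Let $\mathrm{Ham}(B',\omega)_W\subset \mathrm{Ham}(M,\omega)$ consist of the forms in $B'_W$ and of the Hamiltonian pairs in $B'_W\oplus\mathfrak Y_W$, and $\mathrm{Ham}(B',\omega)_0$ of the forms in $B'_0$ and of the Hamiltonian pairs in $B'_0\oplus\mathcal F$. Then: 1. $\mathcal F=C^\infty(M)\cdot F+I_S\,\mathfrak X(M)$. 2. $\mathrm{Ham}(M,\omega)$ with these brackets is an $L_\infty$-algebra (with the sign convention $\sum_{i+j=n+1}(-1)^{i(j-1)}\sum_{\sigma}\chi(\sigma)\,l_j(l_i\otimes\mathrm{id})\circ\sigma=0$, where $\sigma$ runs over the $(i,n-i)$-unshuffles and $\chi(\sigma)$ is the signature times the Koszul sign), $\mathrm{Ham}(B',\omega)_0\subset\mathrm{Ham}(B',\omega)_W$, the brackets preserve $\mathrm{Ham}(B',\omega)_W$, and they descend to an $L_\infty$-algebra structure on the graded quotient $\mathrm{Ham}(B',\omega)_W/\mathrm{Ham}(B',\omega)_0$, the reduced $L_\infty$-algebra of observables. 3. The reduced $L_\infty$-algebra of observables is given explicitly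 by $$\frac{\mathrm{Ham}(B',\omega)_W}{\mathrm{Ham}(B',\omega)_0}=\frac{\left\{\begin{array}{l}\alpha\in\Omega^{\le k-2}(M),\text{ respectively}\\(\alpha,X)\in\Omega^{k-1}(M)\oplus\mathfrak X(M)\end{array}\ \middle|\ \begin{array}{l}\iota_\xi\alpha\in B_0,\ \mathcal L_\xi\alpha\in B_0\ \ \forall\xi\in F\\ \hline \iota_X\omega=-d\alpha,\ X\in\mathfrak X(A)_W,\\ {[\xi,X]}\in\mathcal F\ \ \forall\xi\in F\end{array}\right\}}{\left\{\begin{array}{l}\alpha\in\Omega^{\le k-2}(M),\text{ respectively}\\(\alpha,X)\in\Omega^{k-1}(M)\oplus\mathfrak X(M)\end{array}\ \middle|\ \begin{array}{l}\alpha\in B_0\\ \hline \iota_X\omega=-d\alpha,\ X\in\mathcal F\end{array}\right\}},$$ that is, the two numerators coincide and the two denominators coincide (the conditions below the lines apply only to pairs), with $\mathcal F=C^\infty(M)\cdot F+I_S\,\mathfrak X(M)$. -/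

import Mathlib

open scoped Manifold

set_option linter.unusedSectionVars false

namespace ConstraintReduction

noncomputable section

section Algebra

/-! ### The Cartan calculus of derivations of a commutative algebra -/

variable (K : Type*) [Field K] [CharZero K] (R : Type*) [CommRing R] [Algebra K R]

/-- The Lie--Rinehart algebra `𝔛(R)` of `K`-linear derivations of `R`. -/
abbrev Der := Derivation K R R

/-- The space `CE^n(𝔛(R)) = (Λ^n_R 𝔛(R))^*` of `n`-forms: `R`-multilinear alternating maps
from `𝔛(R)` to `R`. -/
abbrev Form (n : ℕ) := (Der K R) [⋀^Fin n]→ₗ[R] R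

variable {K R}

instance {n : ℕ} : IsScalarTower K R (Form K R n) :=
  ⟨fun a r α => by ext v; simp⟩

/-- The value of the Chevalley--Eilenberg differential of an `n`-form on `n + 1` derivations
`v₀, …, vₙ`, i.e.
`∑ᵢ (-1)ⁱ vᵢ(α(v₀,…,v̂ᵢ,…,vₙ)) + ∑_{a<b} (-1)^(a+b) α([v_a,v_b],v₀,…,v̂_a,…,v̂_b,…,vₙ)`.
Pairs `a < b` in `Fin (n + 2)` are written `a = i.castSucc`, `b = j.succ` with `i ≤ j`. -/
def ceDiffFun : ∀ {n : ℕ}, Form K R n → (Fin (n + 1) → Der K R) → R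
  | 0, α, v => v 0 (α (Fin.removeNth 0 v))
  | n + 1, α, v =>
      (∑ i : Fin (n + 2), (-1 : ℤ) ^ (i : ℕ) • v i (α (i.removeNth v))) +
      ∑ i : Fin (n + 1), ∑ j ∈ Finset.Ici i, (-1 : ℤ) ^ (i + j + 1 : ℕ) •
        α (Matrix.vecCons ⁅v i.castSucc, v j.succ⁆ (j.removeNth (i.castSucc.removeNth v)))

/-- Auxiliary: a form as a `K`-multilinear alternating map. -/
def auxRestrict {n : ℕ} (α : Form K R n) : (Der K R) [⋀^Fin n]→ₗ[K] R :=
  { α.toMultilinearMap.restrictScalars K with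
    map_eq_zero_of_eq' := fun v _ _ h hij => α.map_eq_zero_of_eq v h hij }

theorem auxRestrict_apply {n : ℕ} (α : Form K R n) (v : Fin n → Der K R) :
    auxRestrict α v = α v := rfl

/-- Auxiliary: `X ↦ X ∘ α`. -/
def auxDeriv {n : ℕ} (α : Form K R n) :
    Der K R →ₗ[K] (Der K R) [⋀^Fin n]→ₗ[K] R where
  toFun X := (X : R →ₗ[K] R).compAlternatingMap (auxRestrict α)
  map_add' X Y := by ext v; simp
  map_smul' c X := by ext v; simp

/-- Auxiliary: `(X, Y) ↦ ι_{[X,Y]} α`. -/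
def auxBracket {n : ℕ} (α : Form K R (n + 1)) :
    Der K R →ₗ[K] Der K R →ₗ[K] (Der K R) [⋀^Fin n]→ₗ[K] R :=
  LinearMap.mk₂ K (fun X Y => (auxRestrict α).curryLeft ⁅X, Y⁆)
    (fun X X' Y => by rw [add_lie, map_add])
    (fun c X Y => by rw [smul_lie, map_smul])
    (fun X Y Y' => by rw [lie_add, map_add])
    (fun c X Y => by rw [lie_smul, map_smul])

/-- Auxiliary: the Chevalley--Eilenberg differential as a `K`-multilinear alternating map. -/
def auxDiff : ∀ {n : ℕ}, Form K R n → (Der K R) [⋀^Fin (n + 1)]→ₗ[K] R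
  | 0, α => AlternatingMap.alternatizeUncurryFin (auxDeriv α)
  | _ + 1, α => AlternatingMap.alternatizeUncurryFin (auxDeriv α) - (2⁻¹ : K) •
      AlternatingMap.alternatizeUncurryFin
        (AlternatingMap.alternatizeUncurryFinLM ∘ₗ auxBracket α)

theorem auxDiff_apply : ∀ {n : ℕ} (α : Form K R n) (v : Fin (n + 1) → Der K R),
    auxDiff α v = ceDiffFun α v
  | 0, α, v => by
      simp [auxDiff, ceDiffFun, AlternatingMap.alternatizeUncurryFin_apply, auxDeriv,
        auxRestrict_apply]
  | n + 1, α, v => by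
      have key : ∀ (i j : Fin (n + 1)), (2⁻¹ : K) • ((-1 : ℤ) ^ (i + j : ℕ) •
          (auxBracket α (v i.castSucc) (v j.succ) (j.removeNth (i.castSucc.removeNth v)) -
            auxBracket α (v j.succ) (v i.castSucc) (j.removeNth (i.castSucc.removeNth v))))
          = - ((-1 : ℤ) ^ (i + j + 1 : ℕ) •
        α (Matrix.vecCons ⁅v i.castSucc, v j.succ⁆ (j.removeNth (i.castSucc.removeNth v)))) := by
        intro i j
        have h1 : auxBracket α (v j.succ) (v i.castSucc)
            = - auxBracket α (v i.castSucc) (v j.succ) := by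
          simp only [auxBracket, LinearMap.mk₂_apply]
          rw [← lie_skew, map_neg]
        rw [h1, AlternatingMap.neg_apply, sub_neg_eq_add, ← two_smul K, smul_comm _ (2 : K),
          smul_smul, inv_mul_cancel₀ two_ne_zero, one_smul, pow_succ, mul_neg_one, neg_smul,
          neg_neg]
        rfl
      simp only [auxDiff, ceDiffFun, AlternatingMap.sub_apply, AlternatingMap.smul_apply]
      rw [AlternatingMap.alternatizeUncurryFin_alternatizeUncurryFinLM_comp_apply,
        AlternatingMap.alternatizeUncurryFin_apply]
      simp only [Finset.smul_sum, key, Finset.sum_neg_distrib, sub_neg_eq_add]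
      rfl

theorem removeNth_zero_vecCons {X : Type*} {n : ℕ} (x : X) (w : Fin n → X) :
    Fin.removeNth 0 (Matrix.vecCons x w) = w := rfl

theorem removeNth_succ_vecCons {X : Type*} {n : ℕ} (x : X) (w : Fin (n + 1) → X)
    (k : Fin (n + 1)) :
    Fin.removeNth k.succ (Matrix.vecCons x w) = Matrix.vecCons x (k.removeNth w) := by
  ext i
  cases i using Fin.cases <;> simp [Fin.removeNth]

theorem map_vecCons_vecCons_smul {n : ℕ} (α : Form K R (n + 2)) (c : R) (y x : Der K R)
    (w : Fin n → Der K R) :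
    α (Matrix.vecCons y (Matrix.vecCons (c • x) w)) =
      c • α (Matrix.vecCons y (Matrix.vecCons x w)) :=
  (α.curryLeft y).map_vecCons_smul w c x

theorem ceDiffFun_smul_zero : ∀ {n : ℕ} (α : Form K R n) (c : R) (x : Der K R)
    (w : Fin n → Der K R),
    ceDiffFun α (Matrix.vecCons (c • x) w) = c • ceDiffFun α (Matrix.vecCons x w)
  | 0, α, c, x, w => by
      simp [ceDiffFun]
  | n + 1, α, c, x, w => by
      have h1 : ∀ y : Der K R, ⁅c • x, y⁆ = c • ⁅x, y⁆ - y c • x := by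
        intro y
        ext r
        simp only [Derivation.commutator_apply, Derivation.sub_apply, Derivation.smul_apply,
          smul_eq_mul, Derivation.leibniz]
        ring
      have h2 : ∀ z : Fin n → Der K R, ∀ y : Der K R, y (α (Matrix.vecCons (c • x) z)) =
          c • y (α (Matrix.vecCons x z)) + y c * α (Matrix.vecCons x z) := by
        intro z y
        rw [α.map_vecCons_smul, smul_eq_mul, Derivation.leibniz, smul_eq_mul, smul_eq_mul,
          mul_comm (y c)]
      have h3 : ∀ z : Fin n → Der K R, ∀ y : Der K R,
          α (Matrix.vecCons (c • ⁅x, y⁆ - y c • x) z) =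
          c • α (Matrix.vecCons ⁅x, y⁆ z) - y c * α (Matrix.vecCons x z) := by
        intro z y
        have h := congrArg (fun f => f z) ((α.curryLeft).map_sub (c • ⁅x, y⁆) (y c • x))
        rw [map_smul, map_smul] at h
        exact h
      have h4 : ∀ i : Fin n, ∀ j ∈ Finset.Ici i.succ,
          (-1 : ℤ) ^ (i.succ + j + 1 : ℕ) • α (Matrix.vecCons
            ⁅Matrix.vecCons (c • x) w i.succ.castSucc, Matrix.vecCons (c • x) w j.succ⁆
            (j.removeNth (i.succ.castSucc.removeNth (Matrix.vecCons (c • x) w)))) =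
          c • ((-1 : ℤ) ^ (i.succ + j + 1 : ℕ) • α (Matrix.vecCons
            ⁅Matrix.vecCons x w i.succ.castSucc, Matrix.vecCons x w j.succ⁆
            (j.removeNth (i.succ.castSucc.removeNth (Matrix.vecCons x w))))) := by
        intro i j hj
        obtain ⟨m, rfl⟩ : ∃ m, n = m + 1 := ⟨n - 1, by have := i.pos; omega⟩
        obtain ⟨j', rfl⟩ : ∃ j', j = Fin.succ j' :=
          Fin.exists_succ_eq.2 (by
            rintro rfl
            simp at hj) |>.imp fun _ h => h.symm
        rw [← Fin.succ_castSucc, removeNth_succ_vecCons, removeNth_succ_vecCons,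
          removeNth_succ_vecCons, removeNth_succ_vecCons, map_vecCons_vecCons_smul, smul_comm]
        simp only [Matrix.cons_val_succ]
      refine (congrArg₂ (· + ·) (Fin.sum_univ_succ _) (Fin.sum_univ_succ _)).trans
        (Eq.trans ?_ (congrArg (c • ·)
          (congrArg₂ (· + ·) (Fin.sum_univ_succ _) (Fin.sum_univ_succ _))).symm)
      rw [Finset.sum_congr rfl (fun i _ => Finset.sum_congr rfl (h4 i))]
      simp only [removeNth_succ_vecCons, removeNth_zero_vecCons, Matrix.cons_val_zero,
        Matrix.cons_val_succ, Fin.castSucc_zero, Fin.val_zero, Fin.val_succ, h1, h2, h3,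
        smul_add, smul_sub, Finset.smul_sum, Finset.sum_add_distrib, Finset.sum_sub_distrib,
        Derivation.smul_apply, smul_comm c, show Finset.Ici (0 : Fin (n + 1)) = Finset.univ from
          Finset.Ici_bot, zero_add]
      abel

theorem ceDiffFun_update_smul {n : ℕ} (α : Form K R n) (v : Fin (n + 1) → Der K R)
    (i : Fin (n + 1)) (c : R) (x : Der K R) :
    ceDiffFun α (Function.update v i (c • x)) = c • ceDiffFun α (Function.update v i x) := by
  rw [← Fin.insertNth_removeNth, ← Fin.insertNth_removeNth, ← auxDiff_apply, ← auxDiff_apply,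
    AlternatingMap.map_insertNth, AlternatingMap.map_insertNth, auxDiff_apply, auxDiff_apply,
    ceDiffFun_smul_zero, smul_comm]

/-- The Chevalley--Eilenberg (de Rham) differential. -/
def ceDiff {n : ℕ} : Form K R n →ₗ[K] Form K R (n + 1) where
  toFun α :=
    { toFun := ceDiffFun α
      map_update_add' := by
        intro inst v i x y
        rw [Subsingleton.elim inst (instDecidableEqFin _)]
        rw [← auxDiff_apply, ← auxDiff_apply, ← auxDiff_apply, AlternatingMap.map_update_add]
      map_update_smul' := by
        intro inst v i c x
        rw [Subsingleton.elim inst (instDecidableEqFin _)]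
        exact ceDiffFun_update_smul α v i c x
      map_eq_zero_of_eq' := by
        intro v i j h hij
        rw [← auxDiff_apply]
        exact AlternatingMap.map_eq_zero_of_eq _ v h hij }
  map_add' α β := by
    ext v
    change ceDiffFun (α + β) v = ceDiffFun α v + ceDiffFun β v
    cases n with
    | zero => simp [ceDiffFun]
    | succ n =>
      simp only [ceDiffFun, AlternatingMap.add_apply, map_add, smul_add, Finset.sum_add_distrib]
      abel
  map_smul' c α := by
    ext v
    change ceDiffFun (c • α) v = c • ceDiffFun α v
    cases n with
    | zero => simp [ceDiffFun]
    | succ n =>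
      simp only [ceDiffFun, AlternatingMap.smul_apply, Derivation.map_smul, smul_add,
        Finset.smul_sum, smul_comm c]

/-- The contraction `ι_X`, insertion into the first slot; it is zero on `0`-forms. -/
def contr (X : Der K R) : ∀ {n : ℕ}, Form K R n →ₗ[R] Form K R (n - 1)
  | 0 => 0
  | _ + 1 => AlternatingMap.curryLeftLinearMap.flip X

/-- The Lie derivative `L_X = ι_X ∘ d + d ∘ ι_X`. -/
def lieDer (X : Der K R) : ∀ {n : ℕ}, Form K R n →ₗ[K] Form K R n
  | 0 => (contr X).restrictScalars K ∘ₗ ceDiff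
  | n + 1 => LinearMap.comp (M₂ := Form K R (n + 2)) ((contr X).restrictScalars K) ceDiff +
      LinearMap.comp (M₂ := Form K R n) ceDiff ((contr X).restrictScalars K)

/-- The iterated contraction `ι_{X₁} ⋯ ι_{X_j} α`. -/
def iterContr : ∀ {j m : ℕ}, (Fin j → Der K R) → Form K R (m + j) → Form K R m
  | 0, _, _, α => α
  | j + 1, _, X, α => iterContr (Fin.init X) (contr (X (Fin.last j)) α)

/-! ### The constraint algebra `(R, R, I)` and its derivations and forms -/

/-- `𝔛(A)_W`: the derivations preserving `I`. -/
def derW (I : Ideal R) : Submodule R (Der K R) where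
  carrier := {X | ∀ f ∈ I, X f ∈ I}
  add_mem' hX hY f hf := I.add_mem (hX f hf) (hY f hf)
  zero_mem' _ _ := I.zero_mem
  smul_mem' c _ hX f hf := I.mul_mem_left c (hX f hf)

/-- `𝔛(A)_0`: the derivations mapping all of `R` into `I`. -/
def derN (I : Ideal R) : Submodule R (Der K R) where
  carrier := {X | ∀ f, X f ∈ I}
  add_mem' hX hY f := I.add_mem (hX f) (hY f)
  zero_mem' _ := I.zero_mem
  smul_mem' c _ hX f := I.mul_mem_left c (hX f)

/-- `CE^n(𝔛(A))_0`: the forms with values in `I` on derivations preserving `I`. -/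
def formN (I : Ideal R) (n : ℕ) : Submodule R (Form K R n) where
  carrier := {α | ∀ v : Fin n → Der K R, (∀ i, v i ∈ derW I) → α v ∈ I}
  add_mem' hα hβ v hv := I.add_mem (hα v hv) (hβ v hv)
  zero_mem' _ _ := I.zero_mem
  smul_mem' c _ hα v hv := I.mul_mem_left c (hα v hv)

/-- `CE^n(𝔛(A))_W`: the forms `α` such that `α(w, v₂, …, vₙ) ∈ I` whenever `w ∈ 𝔛(A)_0` and
`v₂, …, vₙ ∈ 𝔛(A)_W`. (The condition `α(v₁, …, vₙ) ∈ A_W` is void since `A_W = R`.) -/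
def formW (I : Ideal R) (n : ℕ) : Submodule R (Form K R n) where
  carrier := {α | ∀ w ∈ derN (K := K) I, contr w α ∈ formN I (n - 1)}
  add_mem' hα hβ w hw := by rw [map_add]; exact add_mem (hα w hw) (hβ w hw)
  zero_mem' w _ := by rw [map_zero]; exact zero_mem _
  smul_mem' c _ hα w hw := by rw [map_smul]; exact Submodule.smul_mem _ c (hα w hw)

/-! ### Symmetries and basic forms -/

/-- The smallest Lie--Rinehart subalgebra `𝓕` of `𝔛(R)` (an `R`-submodule closed under the Lie
bracket) containing both `F` and `𝔛(A)_0`. -/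
def symLR (I : Ideal R) (F : Set (Der K R)) : Submodule R (Der K R) :=
  sInf {N | F ⊆ N ∧ derN I ≤ N ∧ ∀ X ∈ N, ∀ Y ∈ N, ⁅X, Y⁆ ∈ N}

/-- `𝔜_W = 𝓝(𝓕, 𝔛(A)_W)`, the normalizer of `𝓕` in `𝔛(A)_W`. The other two components of the
constraint Lie--Rinehart algebra `𝔜` are `𝔜_T = 𝔛(R)` and `𝔜_0 = 𝓕`. -/
def normW (I : Ideal R) (L : Submodule R (Der K R)) : Submodule K (Der K R) where
  carrier := {X | X ∈ derW I ∧ ∀ ξ ∈ L, ⁅ξ, X⁆ ∈ L}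
  add_mem' hX hY := ⟨add_mem hX.1 hY.1, fun ξ hξ => by
    rw [lie_add]; exact add_mem (hX.2 ξ hξ) (hY.2 ξ hξ)⟩
  zero_mem' := ⟨zero_mem _, fun ξ _ => by rw [lie_zero]; exact zero_mem _⟩
  smul_mem' c _ hX := ⟨(derW I).smul_of_tower_mem c hX.1, fun ξ hξ => by
    rw [lie_smul]; exact L.smul_of_tower_mem c (hX.2 ξ hξ)⟩

/-- `B'_W` in degree `n`, for `B = CE(𝔛(A))` and `𝔜_0 = L`: the forms `α ∈ B_W` with
`ι_ξ α, L_ξ α ∈ B_0` for all `ξ ∈ L`. (The other components are `B'_T = B_T`, `B'_0 = B_0`.) -/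
def basicW (I : Ideal R) (L : Submodule R (Der K R)) (n : ℕ) : Submodule K (Form K R n) where
  carrier := {α | α ∈ formW I n ∧ ∀ ξ ∈ L, contr ξ α ∈ formN I (n - 1) ∧ lieDer ξ α ∈ formN I n}
  add_mem' hα hβ := ⟨add_mem hα.1 hβ.1, fun ξ hξ => by
    rw [map_add, map_add]
    exact ⟨add_mem (hα.2 ξ hξ).1 (hβ.2 ξ hξ).1, add_mem (hα.2 ξ hξ).2 (hβ.2 ξ hξ).2⟩⟩
  zero_mem' := ⟨zero_mem _, fun ξ _ => by
    rw [map_zero, map_zero]; exact ⟨zero_mem _, zero_mem _⟩⟩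
  smul_mem' c _ hα := ⟨(formW I n).smul_of_tower_mem c hα.1, fun ξ hξ => by
    rw [LinearMap.map_smul_of_tower, map_smul]
    exact ⟨(formN I _).smul_of_tower_mem c (hα.2 ξ hξ).1,
      (formN I _).smul_of_tower_mem c (hα.2 ξ hξ).2⟩⟩

/-! ### The observables of a closed `(k + 1)`-form, `k = p + 1` -/

variable (K R) in
/-- Tuples of forms of degrees `0, …, k - 1` together with a derivation, where `k = p + 1`. -/
abbrev Amb (p : ℕ) := (∀ m : Fin (p + 1), Form K R m) × Der K R

variable {p : ℕ}

instance : AddCommGroup (Amb K R p) := Prod.instAddCommGroup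

/-- The degree `i` part: `V^(k-1+i)`, together with the derivations if `i = 0`. -/
def ambGrade (p : ℕ) (i : ℤ) : Submodule K (Amb K R p) where
  carrier := {x | (∀ m : Fin (p + 1), (m : ℤ) ≠ p + i → x.1 m = 0) ∧ (i ≠ 0 → x.2 = 0)}
  add_mem' hx hy := ⟨fun m hm => by simp [hx.1 m hm, hy.1 m hm],
    fun hi => by simp [hx.2 hi, hy.2 hi]⟩
  zero_mem' := ⟨fun _ _ => rfl, fun _ => rfl⟩
  smul_mem' c _ hx := ⟨fun m hm => by simp [hx.1 m hm], fun hi => by simp [hx.2 hi]⟩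

/-- The total space `Ham(V, ω) = V^0 ⊕ ⋯ ⊕ V^(k-2) ⊕ Ham^0(V, ω)` of observables, where
`Ham^0(V, ω) = {(α, X) ∈ V^(k-1) ⊕ 𝔛(R) | ι_X ω = - d α}`. -/
def ham (ω : Form K R (p + 2)) : Submodule K (Amb K R p) where
  carrier := {x | (contr x.2 ω : Form K R (p + 1)) = -ceDiff (x.1 (Fin.last p))}
  add_mem' {x y} hx hy := by
    have hx' : ω.curryLeft x.2 = -ceDiff (x.1 (Fin.last p)) := hx
    have hy' : ω.curryLeft y.2 = -ceDiff (y.1 (Fin.last p)) := hy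
    change ω.curryLeft (x.2 + y.2) = -ceDiff (x.1 (Fin.last p) + y.1 (Fin.last p))
    rw [map_add, map_add, hx', hy', neg_add]
  zero_mem' := by
    change ω.curryLeft 0 = -ceDiff (K := K) 0
    rw [map_zero, map_zero, neg_zero]
  smul_mem' c x hx := by
    have hx' : ω.curryLeft x.2 = -ceDiff (x.1 (Fin.last p)) := hx
    change ω.curryLeft (c • x.2) = -ceDiff (c • x.1 (Fin.last p))
    rw [LinearMap.map_smul_of_tower, map_smul, hx', smul_neg]

/-- `Ham(B', ω)_W`: forms in `B'_W`, and Hamiltonian pairs in `B'_W ⊕ 𝔜_W`. -/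
def hamW (I : Ideal R) (F : Set (Der K R)) (ω : Form K R (p + 2)) : Submodule K (Amb K R p) :=
  ham ω ⊓ (Submodule.pi Set.univ fun m : Fin (p + 1) => basicW I (symLR I F) m).prod
    (normW I (symLR I F))

/-- `Ham(B', ω)_0`: forms in `B'_0 = B_0`, and Hamiltonian pairs in `B'_0 ⊕ 𝔜_0`. -/
def hamN (I : Ideal R) (F : Set (Der K R)) (ω : Form K R (p + 2)) : Submodule K (Amb K R p) :=
  ham ω ⊓ (Submodule.pi Set.univ fun m : Fin (p + 1) => (formN I m).restrictScalars K).prod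
    ((symLR I F).restrictScalars K)

/-- The reduced space `Ham(B', ω)_W / Ham(B', ω)_0`. -/
abbrev Red (I : Ideal R) (F : Set (Der K R)) (ω : Form K R (p + 2)) :=
  ↥(hamW I F ω) ⧸ (hamN I F ω).submoduleOf (hamW I F ω)

/-- The grading of `Ham(V, ω)`. -/
def hamGrade (ω : Form K R (p + 2)) (i : ℤ) : Submodule K (ham ω) :=
  (ambGrade p i).comap (ham ω).subtype

/-- The grading of the reduced space. -/
def redGrade (I : Ideal R) (F : Set (Der K R)) (ω : Form K R (p + 2)) (i : ℤ) :
    Submodule K (Red I F ω) :=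
  ((ambGrade p i).comap (hamW I F ω).subtype).map
    ((hamN I F ω).submoduleOf (hamW I F ω)).mkQ

/-- The brackets `l_j` of the observables of `ω`:
* `l_1` is `d` on forms of degree `< k - 1` (with values `(d α, 0)` on those of degree `k - 2`),
  and zero on Hamiltonian pairs;
* `l_2((α, X), (β, Y)) = (- ι_X ι_Y ω, [X, Y])`;
* `l_j((α₁, X₁), …, (α_j, X_j)) = (-1)^(j+1) ι_{X₁} ⋯ ι_{X_j} ω` for `j ≥ 3`, a form of degree
  `k + 1 - j` (zero if `j > k + 1`);
* `l_j` for `j ≥ 2` is zero as soon as one argument has nonzero degree. -/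
def obsBracket (ω : Form K R (p + 2)) : ∀ j : ℕ, (Fin j → Amb K R p) → Amb K R p
  | 0, _ => 0
  | 1, x => (fun m => Fin.cases (motive := fun m : Fin (p + 1) => Form K R m) 0
      (fun m' : Fin p => ceDiff ((x 0).1 m'.castSucc)) m, 0)
  | j + 2, x =>
      (fun m => if h : (m : ℕ) + (j + 2) = p + 2 then
          (-1 : ℤ) ^ (j + 3) •
            iterContr (fun i => (x i).2) (ω.domDomCongr (finCongr h.symm))
        else 0,
       if j = 0 then ⁅(x 0).2, (x 1).2⁆ else 0)

end Algebra

/-! ### `L_∞`-algebras -/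

section LInfinity

/-- The sign `χ(σ; x)` with `x_{σ(1)} ∧ ⋯ ∧ x_{σ(n)} = χ(σ; x) x₁ ∧ ⋯ ∧ xₙ` for homogeneous
elements of degrees `deg`, i.e. the signature of `σ` times the Koszul sign: every inversion
contributes `-(-1)^(|x||y|)`. -/
def skewKoszul {n : ℕ} (σ : Equiv.Perm (Fin n)) (deg : Fin n → ℤ) : ℤˣ :=
  ∏ a : Fin n, ∏ b : Fin n,
    if a < b ∧ σ b < σ a then -(Int.negOnePow (deg (σ a) * deg (σ b))) else 1

/-- The `(i, n - i)`-unshuffles: `σ(1) < ⋯ < σ(i)` and `σ(i+1) < ⋯ < σ(n)`. -/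
def unshuffles (n i : ℕ) : Finset (Equiv.Perm (Fin n)) :=
  {σ | ∀ a b : Fin n, a < b → ((b : ℕ) < i ∨ i ≤ (a : ℕ)) → σ a < σ b}

/-- An `L_∞`-algebra structure, in cohomological grading, on a vector space `V` graded by the
subspaces `𝒜 i`: multilinear brackets `l j`, `j ≥ 1`, of degree `2 - j`, which are graded skew
and satisfy, for all `n ≥ 1`,
`∑_{i+j=n+1} (-1)^(i(j-1)) ∑_σ χ(σ; x) l_j(l_i(x_{σ(1)},…,x_{σ(i)}), x_{σ(i+1)},…,x_{σ(n)}) = 0`,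
where `σ` runs over the `(i, n - i)`-unshuffles. (Below, `i` is replaced by `i + 1`.) -/
structure LInfinityAlgebra (K : Type*) [Field K] {V : Type*} [AddCommGroup V] [Module K V]
    (𝒜 : ℤ → Submodule K V) where
  isInternal : DirectSum.IsInternal 𝒜
  /-- the brackets -/
  l : ∀ n : ℕ, MultilinearMap K (fun _ : Fin n => V) V
  l_zero : l 0 = 0
  l_mem : ∀ (n : ℕ) (deg : Fin n → ℤ) (x : Fin n → V), (∀ i, x i ∈ 𝒜 (deg i)) →
    l n x ∈ 𝒜 (∑ i, deg i + 2 - n)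
  skew : ∀ (n : ℕ) (deg : Fin n → ℤ) (x : Fin n → V), (∀ i, x i ∈ 𝒜 (deg i)) →
    ∀ σ : Equiv.Perm (Fin n), l n (fun i => x (σ i)) = skewKoszul σ deg • l n x
  jacobi : ∀ (n : ℕ) (deg : Fin n → ℤ) (x : Fin n → V), (∀ i, x i ∈ 𝒜 (deg i)) →
    ∑ i : Fin n, ∑ σ ∈ unshuffles n (i + 1),
      ((-1 : ℤˣ) ^ (((i : ℕ) + 1) * (n - (i + 1))) * skewKoszul σ deg) •
        l (n - (i + 1) + 1) (Matrix.vecCons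
          (l (i + 1) fun a => x (σ ⟨a, by omega⟩))
          (fun b : Fin (n - (i + 1)) => x (σ ⟨i + 1 + b, by omega⟩))) = 0

end LInfinity

/-! ### Smooth manifolds -/

section Manifold

open scoped ContDiff

variable {n : ℕ} {M : Type*} [TopologicalSpace M] [ChartedSpace (EuclideanSpace ℝ (Fin n)) M]

variable (n M) in
/-- The algebra `C^∞(M)` of a smooth manifold of dimension `n`. Its derivations are the smooth
vector fields `𝔛(M)`, and its forms `Form ℝ C^∞(M) m` are the smooth differential forms. -/
abbrev Smooth := C^∞⟮𝓡 n, M; 𝓘(ℝ, ℝ), ℝ⟯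

/-- The ideal `I_S` of smooth functions vanishing on `S`. -/
def vanishingIdeal (S : Set M) : Ideal (Smooth n M) where
  carrier := {f | ∀ x ∈ S, f x = 0}
  add_mem' hf hg x hx := by simp [hf x hx, hg x hx]
  zero_mem' _ _ := rfl
  smul_mem' c f hf x hx := by simp [hf x hx]

end Manifold

end

end ConstraintReduction

/-! The only geometric input is that a derivation with values in `I` is a combination of derivations
with coefficients in `I`, i.e. `𝔛(A)_0 = I · 𝔛(M)`. It comes from a finite dual basis
(`exists_generators`): finitely many functions `H l` and vector fields `Y l` with `X = ∑ X(H l) • Y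
l` for every `X`. If `X` takes values in `I`, so do all coefficients `X(H l)`. The rest is algebra
over a commutative ring `R` with an ideal `I` satisfying `derN I ≤ I • ⊤`.

Dual basis. Whitney's argument produces `2n + 1` functions whose differentials span every cotangent
space: generic combinations of the countably many cut-off chart coordinates, chosen one vector at a
time to avoid a set of Hausdorff dimension at most `2n`. In a chart, the Gram matrix of their
Jacobian is invertible, and its adjugate expresses every derivation through its values on the `H l`;
a partition of unity glues the local formulas.

Symmetries. The identities `[fξ, X] = f[ξ, X] - X(f)ξ` and `L_{fξ} α = f L_ξ α + df ∧ ι_ξ α`,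
together with `X(I) ⊆ I` on `𝔛(A)_W`, show that `R F + I 𝔛` is closed under the bracket and that the
conditions on basic forms and on the normalizer need testing only on `F`. The condition defining
`B_W` holds for every form.

Brackets. For `ω` closed and Hamiltonian `X_i`, `L_{X_i} ω = 0`, so Cartan calculus gives `d ι_{X_1}
⋯ ι_{X_n} ω` as a signed sum of contractions with one bracket `[X_i, X_j]` (`diffT_multiIns`). This
is the generalized Jacobi identity, as for three or more arguments only `l_j ∘ l_2` and `l_1 ∘ l_n`
survive.

Reduction. Basic forms are stable under `d` and under contraction with the normalizer, and
contracting one with an element of `𝓕` lands in `B_0`. Closedness and the hypothesis on `F` make `ω`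
basic, so `Ham(B', ω)_0` is a homogeneous ideal of `Ham(B', ω)_W`. -/

namespace ConstraintReduction

noncomputable section

section Cartan

variable {K : Type*} [Field K] [CharZero K] {R : Type*} [CommRing R] [Algebra K R]

/-! ### Cartan calculus, degree by degree -/

/-- The contraction `ι_X` on forms of positive degree. -/
def ins (X : Der K R) {n : ℕ} : Form K R (n + 1) →ₗ[R] Form K R n :=
  AlternatingMap.curryLeftLinearMap.flip X

theorem contr_succ (X : Der K R) {n : ℕ} (α : Form K R (n + 1)) : contr X α = ins X α := rfl

theorem ins_apply (X : Der K R) {n : ℕ} (α : Form K R (n + 1)) (v : Fin n → Der K R) :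
    ins X α v = α (Matrix.vecCons X v) := rfl

/-- Allows the Cartan identities below to be proved by induction on the degree: contract both sides
and commute the contraction inwards. -/
theorem form_ext_ins {n : ℕ} {α β : Form K R (n + 1)} (h : ∀ X : Der K R, ins X α = ins X β) : α = β := by
  ext v
  have := congrArg (fun f : Form K R n => f (Fin.tail v)) (h (v 0))
  simp only [ins_apply] at this
  rwa [show Matrix.vecCons (v 0) (Fin.tail v) = v from Fin.cons_self_tail v] at this

theorem ceDiff_apply {n : ℕ} (α : Form K R n) (v : Fin (n + 1) → Der K R) :
    ceDiff α v = ceDiffFun α v := rfl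

theorem lieDer_succ (X : Der K R) {n : ℕ} (α : Form K R (n + 1)) :
    lieDer X α = ins X (ceDiff α) + ceDiff (ins X α) := rfl

theorem lieDer_zero (X : Der K R) (α : Form K R 0) :
    lieDer X α = ins X (ceDiff α) := rfl

theorem map_vecCons_swap {n : ℕ} (α : Form K R (n + 2)) (X Y : Der K R) (v : Fin n → Der K R) :
    α (Matrix.vecCons X (Matrix.vecCons Y v)) = - α (Matrix.vecCons Y (Matrix.vecCons X v)) := by
  rw [← α.map_swap (Matrix.vecCons Y (Matrix.vecCons X v)) (i := 0) (j := 1) (by simp)]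
  congr 1
  ext1 k
  refine Fin.cases ?_ (fun k => Fin.cases ?_ (fun k => ?_) k) k
  · simp
  · simp
  · simp [Equiv.swap_apply_of_ne_of_ne, Fin.ext_iff]

theorem sum_Ici_succ {A : Type*} [AddCommMonoid A] {n : ℕ} (i : Fin n) (f : Fin (n + 1) → A) :
    ∑ j ∈ Finset.Ici i.succ, f j = ∑ j ∈ Finset.Ici i, f j.succ := by
  symm
  refine Finset.sum_bij (fun j _ => j.succ) (by simp) (by simp) ?_ (fun _ _ => rfl)
  intro j hj
  obtain ⟨j', rfl⟩ : ∃ j', j = Fin.succ j' :=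
    Fin.exists_succ_eq.2 (by
      rintro rfl
      simp at hj) |>.imp fun _ h => h.symm
  exact ⟨j', by simpa using hj, rfl⟩

theorem lieDer_zero_apply (X : Der K R) (α : Form K R 0) (v : Fin 0 → Der K R) :
    lieDer X α v = X (α v) := rfl

/-- In `dα(X, v)` the terms in which `X` differentiates or is bracketed give the right-hand side;
all others cancel against `d(ι_X α)(v)`. -/
theorem lieDer_succ_apply (X : Der K R) {n : ℕ} (α : Form K R (n + 1))
    (v : Fin (n + 1) → Der K R) :
    lieDer X α v = X (α v) - ∑ j : Fin (n + 1), (-1 : ℤ) ^ (j : ℕ) •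
      α (Matrix.vecCons ⁅X, v j⁆ (j.removeNth v)) := by
  rw [lieDer_succ, AlternatingMap.add_apply, ins_apply, ceDiff_apply, ceDiff_apply]
  have e1 : ceDiffFun α (Matrix.vecCons X v) = X (α v) -
      (∑ i : Fin (n + 1), (-1 : ℤ) ^ (i : ℕ) • v i (α (Matrix.vecCons X (i.removeNth v)))) -
      (∑ j : Fin (n + 1), (-1 : ℤ) ^ (j : ℕ) •
        α (Matrix.vecCons ⁅X, v j⁆ (j.removeNth v))) +
      ∑ i : Fin n, ∑ j ∈ Finset.Ici i.succ, (-1 : ℤ) ^ (i.succ + j + 1 : ℕ) • α (Matrix.vecCons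
            ⁅Matrix.vecCons X v i.succ.castSucc, Matrix.vecCons X v j.succ⁆
            (j.removeNth (i.succ.castSucc.removeNth (Matrix.vecCons X v)))) := by
    refine (congrArg₂ (· + ·) (Fin.sum_univ_succ _) (Fin.sum_univ_succ _)).trans ?_
    simp only [removeNth_succ_vecCons, removeNth_zero_vecCons, Matrix.cons_val_zero,
      Matrix.cons_val_succ, Fin.castSucc_zero, Fin.val_zero, Fin.val_succ, pow_succ, mul_neg_one,
      neg_smul, Finset.sum_neg_distrib, pow_zero, one_smul, zero_add,
      show Finset.Ici (0 : Fin (n + 1)) = Finset.univ from Finset.Ici_bot]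
    abel
  rw [e1]
  cases n with
  | zero =>
    simp [ceDiffFun, ins_apply]
    abel
  | succ m =>
    -- Both indices shift by one, which preserves parity; the only sign comes from moving `X` past
    -- the bracket.
    have e2 : (∑ i : Fin (m + 1), ∑ j ∈ Finset.Ici i.succ,
          (-1 : ℤ) ^ (i.succ + j + 1 : ℕ) • α (Matrix.vecCons
            ⁅Matrix.vecCons X v i.succ.castSucc, Matrix.vecCons X v j.succ⁆
            (j.removeNth (i.succ.castSucc.removeNth (Matrix.vecCons X v))))) =
        - ∑ i : Fin (m + 1), ∑ j ∈ Finset.Ici i, (-1 : ℤ) ^ (i + j + 1 : ℕ) •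
          ins X α (Matrix.vecCons ⁅v i.castSucc, v j.succ⁆
            (j.removeNth (i.castSucc.removeNth v))) := by
      rw [← Finset.sum_neg_distrib]
      refine Finset.sum_congr rfl fun i _ => ?_
      rw [sum_Ici_succ, ← Finset.sum_neg_distrib]
      refine Finset.sum_congr rfl fun j _ => ?_
      rw [← Fin.succ_castSucc, removeNth_succ_vecCons, removeNth_succ_vecCons, ins_apply]
      simp only [Matrix.cons_val_succ, Fin.val_succ]
      rw [map_vecCons_swap, smul_neg, neg_inj]
      congr 1
      ring
    rw [e2]
    simp only [ceDiffFun, ins_apply]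
    abel

theorem ins_ins_swap (X Y : Der K R) {n : ℕ} (α : Form K R (n + 2)) :
    ins X (ins Y α) = - ins Y (ins X α) := by
  ext v
  rw [AlternatingMap.neg_apply]
  simp only [ins_apply]
  exact map_vecCons_swap α Y X v

theorem ins_ins_self (X : Der K R) {n : ℕ} (α : Form K R (n + 2)) :
    ins X (ins X α) = 0 := by
  ext v
  simp only [ins_apply]
  exact α.map_eq_zero_of_eq _ (i := 0) (j := 1) rfl (by simp)

theorem ins_add_left (X Y : Der K R) {n : ℕ} (α : Form K R (n + 1)) :
    ins (X + Y) α = ins X α + ins Y α :=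
  map_add α.curryLeft X Y

theorem ins_smul_left (c : R) (X : Der K R) {n : ℕ} (α : Form K R (n + 1)) :
    ins (c • X) α = c • ins X α :=
  map_smul α.curryLeft c X

theorem ins_sub_left (X Y : Der K R) {n : ℕ} (α : Form K R (n + 1)) :
    ins (X - Y) α = ins X α - ins Y α :=
  map_sub α.curryLeft X Y

theorem ins_zero_left {n : ℕ} (α : Form K R (n + 1)) : ins (0 : Der K R) α = 0 :=
  map_zero α.curryLeft

/-- The `j = 0` term of the explicit formula for `L_X α` on `(Y, v)` is the contraction with `⁅X,
Y⁆`. -/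
theorem lieDer_ins (X Y : Der K R) {n : ℕ} (α : Form K R (n + 1)) :
    lieDer X (ins Y α) = ins Y (lieDer X α) + ins ⁅X, Y⁆ α := by
  ext v
  rw [AlternatingMap.add_apply, ins_apply, ins_apply, lieDer_succ_apply, Fin.sum_univ_succ]
  cases n with
  | zero =>
    rw [lieDer_zero_apply]
    simp [ins_apply]
  | succ n =>
    rw [lieDer_succ_apply]
    simp only [ins_apply, removeNth_succ_vecCons, removeNth_zero_vecCons, Matrix.cons_val_zero,
      Matrix.cons_val_succ, Fin.val_zero, Fin.val_succ, pow_succ, mul_neg_one, neg_smul,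
      Finset.sum_neg_distrib, pow_zero, one_smul, map_vecCons_swap α _ Y, smul_neg]
    abel

/-- After contraction with `Z`, the induction hypothesis handles `ins Z α`, and the remaining terms
are the Jacobi identity for `X, Y, Z`. -/
theorem lieDer_lie (X Y : Der K R) : ∀ {n : ℕ} (α : Form K R n),
    lieDer ⁅X, Y⁆ α = lieDer X (lieDer Y α) - lieDer Y (lieDer X α)
  | 0, α => by
    ext v
    simp [lieDer_zero_apply, Derivation.commutator_apply]
  | n + 1, α => by
    refine form_ext_ins fun Z => ?_
    have h (X : Der K R) (α : Form K R (n + 1)) :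
        ins Z (lieDer X α) = lieDer X (ins Z α) - ins ⁅X, Z⁆ α := by
      rw [lieDer_ins, add_sub_cancel_right]
    rw [map_sub, h, h, h, h, h, lieDer_lie X Y (ins Z α), map_sub, map_sub, lie_lie,
      ins_sub_left]
    simp only [lieDer_ins, map_add]
    abel

/-- Induction through `ι_Y d = L_Y - d ι_Y`: contracting with `Y` reduces the claim to the
commutators of `L_X` with `ι_Y` and `L_Y`. -/
theorem lieDer_ceDiff (X : Der K R) : ∀ {n : ℕ} (α : Form K R n),
    lieDer X (ceDiff α) = ceDiff (lieDer X α)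
  | 0, α => by
    refine form_ext_ins fun Y => ?_
    have h := lieDer_ins X Y (ceDiff α)
    rw [← lieDer_zero, ← lieDer_zero, lieDer_lie] at h
    rw [← lieDer_zero]
    have := eq_sub_of_add_eq h.symm
    rw [this]
    abel
  | n + 1, α => by
    refine form_ext_ins fun Y => ?_
    have h := lieDer_ins X Y (ceDiff α)
    have e (Y : Der K R) (α : Form K R (n + 1)) :
        ins Y (ceDiff α) = lieDer Y α - ceDiff (ins Y α) := by
      rw [lieDer_succ, add_sub_cancel_right]
    rw [e ⁅X, Y⁆, e Y α, lieDer_lie, map_sub, lieDer_ceDiff X (ins Y α), lieDer_ins, map_add] at h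
    rw [e Y, ← sub_eq_zero]
    have := eq_sub_of_add_eq h.symm
    rw [this]
    abel

/-- Comparing `L_X d α` with `d L_X α` gives `ι_X d d α = d d ι_X α`, which vanishes by induction;
no double sum is expanded. -/
theorem ceDiff_ceDiff : ∀ {n : ℕ} (α : Form K R n), ceDiff (ceDiff α) = 0
  | 0, α => by
    refine form_ext_ins fun X => ?_
    have h := lieDer_succ X (ceDiff α)
    rw [lieDer_ceDiff, lieDer_zero] at h
    rw [map_zero]
    simpa using h
  | n + 1, α => by
    refine form_ext_ins fun X => ?_
    have h := lieDer_succ X (ceDiff α)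
    rw [lieDer_ceDiff, lieDer_succ, map_add, ceDiff_ceDiff (ins X α), add_zero] at h
    rw [map_zero]
    simpa using h

end Cartan

end

end ConstraintReduction

namespace ConstraintReduction

noncomputable section

/-! ### Iterated contractions as one alternating map -/

section SquareZero

variable {R M T : Type*} [CommRing R] [AddCommGroup M] [Module R M] [AddCommGroup T] [Module R T]

/-- For operators `f m` of square zero on `T`, the alternating map
`(m₁, …, mₙ) ↦ f m₁ (⋯ (f mₙ t))`. -/
def iterOp (f : M →ₗ[R] Module.End R T) (hf : ∀ m, f m * f m = 0) (t : T) (n : ℕ) :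
    M [⋀^Fin n]→ₗ[R] T :=
  -- Operators of square zero define an action of the exterior algebra, so the iterate is
  -- alternating because it factors through `ιMulti`.
  (LinearMap.applyₗ t ∘ₗ (ExteriorAlgebra.lift R ⟨f, hf⟩).toLinearMap).compAlternatingMap
    (ExteriorAlgebra.ιMulti R n)

theorem iterOp_zero (f : M →ₗ[R] Module.End R T) (hf : ∀ m, f m * f m = 0) (t : T)
    (v : Fin 0 → M) : iterOp f hf t 0 v = t := by
  simp [iterOp]

theorem iterOp_succ (f : M →ₗ[R] Module.End R T) (hf : ∀ m, f m * f m = 0) (t : T) {n : ℕ}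
    (v : Fin (n + 1) → M) : iterOp f hf t (n + 1) v = f (v 0) (iterOp f hf t n (Fin.tail v)) := by
  simp [iterOp, ExteriorAlgebra.ιMulti_succ_apply]
  rfl

end SquareZero

section TotalForms

variable (K : Type*) [Field K] [CharZero K] (R : Type*) [CommRing R] [Algebra K R]

/-! ### Operators on the total space of forms -/

/-- Families of forms, one in every degree. -/
abbrev TotalForm := ∀ n : ℕ, Form K R n

variable {K R}

/-- The contraction operators on families of forms, as a linear map in the derivation. -/
def insT : Der K R →ₗ[R] Module.End R (TotalForm K R) where
  toFun X := LinearMap.pi fun n => ins X ∘ₗ LinearMap.proj (n + 1)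
  map_add' X Y := by
    ext1 α; funext n; exact ins_add_left X Y _
  map_smul' c X := by
    ext1 α; funext n; exact ins_smul_left c X _

theorem insT_apply (X : Der K R) (α : TotalForm K R) (n : ℕ) : insT X α n = ins X (α (n + 1)) := rfl

/-- The Chevalley--Eilenberg differential on families of forms. -/
def diffT : TotalForm K R →ₗ[K] TotalForm K R :=
  LinearMap.pi fun
    | 0 => 0
    | n + 1 => ceDiff ∘ₗ LinearMap.proj n

theorem diffT_succ (α : TotalForm K R) (n : ℕ) : diffT α (n + 1) = ceDiff (α n) := rfl

/-- The Lie derivative on families of forms. -/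
def lieT (X : Der K R) : TotalForm K R →ₗ[K] TotalForm K R :=
  LinearMap.pi fun n => lieDer X ∘ₗ LinearMap.proj n

theorem lieT_apply (X : Der K R) (α : TotalForm K R) (n : ℕ) : lieT X α n = lieDer X (α n) := rfl

/-- Cartan's formula in all degrees at once. In degree `0` it is consistent because `diffT` is zero
there. Working with families avoids casts between the degrees of iterated contractions. -/
theorem diffT_insT (X : Der K R) (α : TotalForm K R) :
    diffT (insT X α) = lieT X α - insT X (diffT α) := by
  funext n
  rw [Pi.sub_apply, eq_sub_iff_add_eq]
  cases n with
  | zero => exact zero_add _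
  | succ n => exact add_comm _ _

theorem lieT_insT (X Y : Der K R) (α : TotalForm K R) :
    lieT X (insT Y α) = insT Y (lieT X α) + insT ⁅X, Y⁆ α := by
  funext n
  exact lieDer_ins X Y (α (n + 1))

theorem insT_mul_self (X : Der K R) :
    (insT X * insT X : Module.End R (TotalForm K R)) = 0 := by
  ext1 α; funext n; exact ins_ins_self X (α (n + 2))

theorem insT_insT_swap (X Y : Der K R) (α : TotalForm K R) :
    insT X (insT Y α) = - insT Y (insT X α) := by
  funext n; exact ins_ins_swap X Y (α (n + 2))

/-- `(X₁, …, Xₙ) ↦ ι_{X₁} ⋯ ι_{Xₙ} α`, as an alternating map. -/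
def multiIns (α : TotalForm K R) (n : ℕ) : (Der K R) [⋀^Fin n]→ₗ[R] TotalForm K R :=
  iterOp insT insT_mul_self α n

theorem multiIns_zero (α : TotalForm K R) (X : Fin 0 → Der K R) : multiIns α 0 X = α :=
  iterOp_zero _ _ _ _

theorem multiIns_succ (α : TotalForm K R) {n : ℕ} (X : Fin (n + 1) → Der K R) :
    multiIns α (n + 1) X = insT (X 0) (multiIns α n (Fin.tail X)) :=
  iterOp_succ _ _ _ _

theorem multiIns_cons (α : TotalForm K R) {n : ℕ} (Y : Der K R) (X : Fin n → Der K R) :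
    multiIns α (n + 1) (Matrix.vecCons Y X) = insT Y (multiIns α n X) :=
  multiIns_succ α _

theorem multiIns_cons_cons_swap (α : TotalForm K R) {n : ℕ} (Y Z : Der K R)
    (X : Fin n → Der K R) :
    multiIns α (n + 2) (Matrix.vecCons Y (Matrix.vecCons Z X)) =
      - insT Z (multiIns α (n + 1) (Matrix.vecCons Y X)) := by
  rw [multiIns_cons, multiIns_cons, multiIns_cons, insT_insT_swap]

/-- `L_Y` passes through the contractions, leaving one `⁅Y, X j⁆` at a time until it reaches `ω` and
vanishes; moving the bracket to the front past `j` contractions gives the sign. -/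
theorem lieT_multiIns {ω : TotalForm K R} (Y : Der K R) (hω : lieT Y ω = 0) :
    ∀ {n : ℕ} (X : Fin (n + 1) → Der K R), lieT Y (multiIns ω (n + 1) X) =
      ∑ j : Fin (n + 1), (-1 : ℤ) ^ (j : ℕ) •
        multiIns ω (n + 1) (Matrix.vecCons ⁅Y, X j⁆ (j.removeNth X))
  | 0, X => by
    simp [multiIns_succ, multiIns_zero, lieT_insT, hω]
  | n + 1, X => by
    obtain ⟨Z, X, rfl⟩ : ∃ Z X', X = Matrix.vecCons Z X' :=
      ⟨X 0, Fin.tail X, (Fin.cons_self_tail X).symm⟩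
    rw [Fin.sum_univ_succ, multiIns_cons, lieT_insT, lieT_multiIns Y hω X]
    simp only [removeNth_succ_vecCons, removeNth_zero_vecCons, Matrix.cons_val_zero,
      Matrix.cons_val_succ, Fin.val_zero, Fin.val_succ, pow_succ, mul_neg_one, neg_smul,
      pow_zero, one_smul, multiIns_cons_cons_swap, smul_neg, neg_neg, map_sum, map_zsmul]
    rw [← multiIns_cons, add_comm]

/-- Induction through `d ι_Z = L_Z - ι_Z d` with `Z` the first entry: `L_Z` contributes the pairs
containing `Z`, and `-ι_Z d` the others, its sign being absorbed when the bracket is moved in front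
of `Z`. -/
theorem diffT_multiIns {ω : TotalForm K R} (hω : diffT ω = 0) :
    ∀ {n : ℕ} (X : Fin (n + 2) → Der K R), (∀ i, lieT (X i) ω = 0) →
      diffT (multiIns ω (n + 2) X) =
      ∑ i : Fin (n + 1), ∑ j ∈ Finset.Ici i, (-1 : ℤ) ^ (i + j : ℕ) • multiIns ω (n + 1)
        (Matrix.vecCons ⁅X i.castSucc, X j.succ⁆ (j.removeNth (i.castSucc.removeNth X)))
  | 0, X, hX => by
    simp [multiIns_succ, multiIns_zero, diffT_insT, lieT_insT, hω, hX, Fin.tail]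
  | n + 1, X, hX => by
    obtain ⟨Z, X, rfl⟩ : ∃ Z X', X = Matrix.vecCons Z X' :=
      ⟨X 0, Fin.tail X, (Fin.cons_self_tail X).symm⟩
    rw [Fin.sum_univ_succ, multiIns_cons, diffT_insT, lieT_multiIns Z (hX 0) X,
      diffT_multiIns hω X (fun i => hX i.succ)]
    simp only [sum_Ici_succ, ← Fin.succ_castSucc, removeNth_succ_vecCons]
    simp only [removeNth_zero_vecCons, Matrix.cons_val_zero, Fin.castSucc_zero,
      Matrix.cons_val_succ, Fin.val_zero, Fin.val_succ, multiIns_cons_cons_swap, smul_neg,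
      map_sum, map_zsmul, zero_add, Finset.sum_neg_distrib, sub_eq_add_neg,
      show Finset.Ici (0 : Fin (n + 2)) = Finset.univ from Finset.Ici_bot]
    congr 2
    refine Finset.sum_congr rfl fun i _ => Finset.sum_congr rfl fun j _ => ?_
    congr 1
    ring

theorem multiIns_single_of_ne {N : ℕ} (ω : Form K R N) : ∀ {n : ℕ} (X : Fin n → Der K R) {m : ℕ},
    m + n ≠ N → multiIns (Pi.single N ω) n X m = 0
  | 0, X, m, h => by
    rw [multiIns_zero]
    exact Pi.single_eq_of_ne h ω
  | n + 1, X, m, h => by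
    rw [multiIns_succ, insT_apply, multiIns_single_of_ne ω _ (by omega), map_zero]

/-- `iterContr` consumes its vectors from the last one, while `multiIns` is unfolded from the first;
this reconciles the two recursions. -/
theorem multiIns_init_last (α : TotalForm K R) : ∀ {n : ℕ} (X : Fin (n + 1) → Der K R),
    multiIns α (n + 1) X = multiIns (insT (X (Fin.last n)) α) n (Fin.init X)
  | 0, X => by
    rw [multiIns_zero, multiIns_succ, multiIns_zero]; rfl
  | n + 1, X => by
    rw [multiIns_succ, multiIns_init_last α (Fin.tail X), multiIns_succ]; rfl

theorem insT_single (X : Der K R) {N : ℕ} (ω : Form K R (N + 1)) :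
    insT X (Pi.single (N + 1) ω) = Pi.single N (ins X ω) := by
  funext m
  rw [insT_apply]
  rcases eq_or_ne m N with rfl | h
  · rw [Pi.single_eq_same, Pi.single_eq_same]
  · rw [Pi.single_eq_of_ne h, Pi.single_eq_of_ne (by omega), map_zero]

theorem multiIns_single_eq_iterContr : ∀ {n m : ℕ} (X : Fin n → Der K R) (ω : Form K R (m + n)),
    multiIns (Pi.single (m + n) ω) n X m = iterContr X ω
  | 0, m, X, ω => by
    rw [multiIns_zero]
    exact Pi.single_eq_same m ω
  | n + 1, m, X, ω => by
    rw [multiIns_init_last]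
    refine Eq.trans ?_ (multiIns_single_eq_iterContr (Fin.init X) (ins (X (Fin.last n)) ω))
    rw [← insT_single]
    rfl

/-- Removes the degree cast in `obsBracket`. -/
theorem single_domDomCongr {N N' : ℕ} (h : N = N') (ω : Form K R N) :
    (Pi.single N' (ω.domDomCongr (finCongr h)) : TotalForm K R) = Pi.single N ω := by
  subst h
  rfl

end TotalForms

end

end ConstraintReduction

namespace ConstraintReduction

noncomputable section

section Unshuffles

/-! ### Unshuffles and signs -/

theorem skewKoszul_eq_sign {n : ℕ} (σ : Equiv.Perm (Fin n)) {deg : Fin n → ℤ}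
    (h : ∀ i, deg i = 0) : skewKoszul σ deg = Equiv.Perm.sign σ := by
  rw [Equiv.Perm.sign_eq_prod_prod_Ioi]
  refine Finset.prod_congr rfl fun a _ => ?_
  rw [← Finset.prod_filter_mul_prod_filter_not Finset.univ (fun b => a < b)]
  rw [Finset.prod_eq_one (s := Finset.univ.filter fun b => ¬ a < b), mul_one]
  · refine Finset.prod_congr (by ext; simp) fun b hb => ?_
    have hab : a < b := by simpa using hb
    have hne : σ a ≠ σ b := fun h => hab.ne (σ.injective h)
    rcases lt_or_gt_of_ne hne with h' | h'
    · simp [hab, h', not_lt_of_gt h']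
    · simp [hab, h', h, not_lt_of_gt h']
  · intro b hb
    simp only [Finset.mem_filter] at hb
    simp [hb.2]

theorem skewKoszul_one {n : ℕ} (deg : Fin n → ℤ) : skewKoszul 1 deg = 1 := by
  refine Finset.prod_eq_one fun a _ => Finset.prod_eq_one fun b _ => ?_
  rw [if_neg]
  rintro ⟨h, h'⟩
  exact lt_asymm h h'

theorem unshuffles_self (n : ℕ) : unshuffles n n = {1} := by
  ext σ
  simp only [unshuffles, Finset.mem_filter, Finset.mem_univ, true_and, Finset.mem_singleton]
  constructor
  · intro h
    have hσ : StrictMono σ := fun a b hab => h a b hab (Or.inl b.2)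
    have := (StrictMono.range_inj hσ strictMono_id).1 (by rw [σ.surjective.range_eq, Set.range_id])
    exact Equiv.ext fun a => congrFun this a
  · rintro rfl a b hab _
    exact hab

/-- The permutation of `Fin (n + 2)` that moves `i.castSucc` and `j.succ` to the front. -/
def pairPerm {n : ℕ} (i j : Fin (n + 1)) : Equiv.Perm (Fin (n + 2)) :=
  i.castSucc.cycleRange.symm * Equiv.Perm.decomposeFin.symm (0, j.cycleRange.symm)

/-- The two cycles moving the entries to the front have signs `(-1)^i` and `(-1)^j`. -/
theorem sign_pairPerm {n : ℕ} (i j : Fin (n + 1)) :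
    Equiv.Perm.sign (pairPerm i j) = (-1) ^ (i + j : ℕ) := by
  rw [pairPerm, Equiv.Perm.sign_mul, Equiv.Perm.decomposeFin.symm_sign, Equiv.Perm.sign_symm,
    Equiv.Perm.sign_symm, Fin.sign_cycleRange, Fin.sign_cycleRange, pow_add]
  simp

theorem pairPerm_zero {n : ℕ} (i j : Fin (n + 1)) : pairPerm i j 0 = i.castSucc := by
  simp [pairPerm]

theorem pairPerm_one {n : ℕ} {i j : Fin (n + 1)} (h : i ≤ j) : pairPerm i j 1 = j.succ := by
  have : (1 : Fin (n + 2)) = Fin.succ 0 := rfl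
  rw [this]
  simp only [pairPerm, Equiv.Perm.mul_apply, Equiv.Perm.decomposeFin_symm_apply_succ,
    Fin.cycleRange_symm_zero, Equiv.swap_self, Equiv.refl_apply, Fin.cycleRange_symm_succ]
  exact Fin.succAbove_of_le_castSucc _ _ (Fin.castSucc_le_castSucc_iff.2 h)

theorem pairPerm_succ_succ {n : ℕ} (i j : Fin (n + 1)) (k : Fin n) :
    pairPerm i j k.succ.succ = i.castSucc.succAbove (j.succAbove k) := by
  simp only [pairPerm, Equiv.Perm.mul_apply, Equiv.Perm.decomposeFin_symm_apply_succ,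
    Equiv.swap_self, Equiv.refl_apply, Fin.cycleRange_symm_succ]

theorem pairPerm_mem_unshuffles {n : ℕ} {i j : Fin (n + 1)} (h : i ≤ j) :
    pairPerm i j ∈ unshuffles (n + 2) 2 := by
  simp only [unshuffles, Finset.mem_filter, Finset.mem_univ, true_and]
  rintro a b hab (hb | ha)
  · have hab' := Fin.lt_def.1 hab
    obtain rfl : b = 1 := Fin.ext ((show (b : ℕ) = 1 by omega).trans (Fin.val_one n).symm)
    obtain rfl : a = 0 := Fin.ext (show (a : ℕ) = 0 by omega)
    rw [pairPerm_zero, pairPerm_one h]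
    exact lt_of_le_of_lt (Fin.castSucc_le_castSucc_iff.2 h) Fin.castSucc_lt_succ
  · have key : ∀ c : Fin (n + 2), 2 ≤ (c : ℕ) → ∃ k : Fin n, c = k.succ.succ := fun c hc =>
      ⟨⟨c - 2, by omega⟩, Fin.ext (by simp; omega)⟩
    obtain ⟨a, rfl⟩ := key a ha
    obtain ⟨b, rfl⟩ := key b (ha.trans (Fin.lt_def.1 hab).le)
    rw [pairPerm_succ_succ, pairPerm_succ_succ]
    exact (Fin.strictMono_succAbove _) ((Fin.strictMono_succAbove _) (by simpa using hab))

/-- The values after the first two are the increasing enumeration of the complement of `{σ 0, σ 1}`,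
hence determined by it. -/
theorem unshuffles_ext {n : ℕ} {σ τ : Equiv.Perm (Fin (n + 2))} (hσ : σ ∈ unshuffles (n + 2) 2)
    (hτ : τ ∈ unshuffles (n + 2) 2) (h0 : σ 0 = τ 0) (h1 : σ 1 = τ 1) : σ = τ := by
  simp only [unshuffles, Finset.mem_filter, Finset.mem_univ, true_and] at hσ hτ
  have mono : ∀ ρ : Equiv.Perm (Fin (n + 2)), (∀ a b : Fin (n + 2), a < b →
      ((b : ℕ) < 2 ∨ 2 ≤ (a : ℕ)) → ρ a < ρ b) → StrictMono fun k : Fin n => ρ k.succ.succ :=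
    fun ρ hρ a b hab => hρ _ _ (by simpa using hab) (Or.inr (by simp))
  have range : ∀ ρ : Equiv.Perm (Fin (n + 2)),
      Set.range (fun k : Fin n => ρ k.succ.succ) = {ρ 0, ρ 1}ᶜ := by
    intro ρ
    ext c
    obtain ⟨c, rfl⟩ := ρ.surjective c
    simp only [Set.mem_range, EmbeddingLike.apply_eq_iff_eq, Set.mem_compl_iff,
      Set.mem_insert_iff, Set.mem_singleton_iff, not_or]
    constructor
    · rintro ⟨k, rfl⟩
      simp [Fin.ext_iff]
    · rintro ⟨hc, hc'⟩
      have h0 : (c : ℕ) ≠ 0 := fun h => hc (Fin.ext h)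
      have h1 : (c : ℕ) ≠ 1 := fun h => hc' (Fin.ext h)
      exact ⟨⟨c - 2, by omega⟩, Fin.ext (by simp; omega)⟩
  have key := (StrictMono.range_inj (mono σ hσ) (mono τ hτ)).1 (by rw [range, range, h0, h1])
  refine Equiv.ext fun c => ?_
  refine Fin.cases h0 (fun c => ?_) c
  cases n with
  | zero => rw [Subsingleton.elim (α := Fin 1) c 0]; exact h1
  | succ n => exact Fin.cases h1 (fun c => congrFun key c) c

/-- A `(2, n)`-unshuffle is the choice of a pair `σ 0 < σ 1`, indexed here in the same way as the
bracket terms of `diffT_multiIns`. -/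
theorem sum_unshuffles_two {A : Type*} [AddCommGroup A] {n : ℕ}
    (f : Equiv.Perm (Fin (n + 2)) → A) :
    ∑ σ ∈ unshuffles (n + 2) 2, f σ =
      ∑ i : Fin (n + 1), ∑ j ∈ Finset.Ici i, f (pairPerm i j) := by
  rw [Finset.sum_sigma']
  symm
  refine Finset.sum_bij (fun x _ => pairPerm x.1 x.2) ?_ ?_ ?_ (fun _ _ => rfl)
  · rintro ⟨i, j⟩ h
    exact pairPerm_mem_unshuffles (by simpa using h)
  · rintro ⟨i, j⟩ h ⟨i', j'⟩ h' e
    simp only [Finset.mem_sigma, Finset.mem_univ, Finset.mem_Ici, true_and] at h h'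
    dsimp only at e
    have e0 := congrArg (fun σ : Equiv.Perm (Fin (n + 2)) => σ 0) e
    have e1 := congrArg (fun σ : Equiv.Perm (Fin (n + 2)) => σ 1) e
    simp only [pairPerm_zero, pairPerm_one h, pairPerm_one h', Fin.castSucc_inj,
      Fin.succ_inj] at e0 e1
    rw [e0, e1]
  · intro σ hσ
    have hlt : σ 0 < σ 1 := by
      simp only [unshuffles, Finset.mem_filter, Finset.mem_univ, true_and] at hσ
      exact hσ 0 1 (by simp) (Or.inl (by simp))
    have h0 : σ 0 ≠ Fin.last (n + 1) := (hlt.trans_le (Fin.le_last _)).ne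
    have h1 : σ 1 ≠ 0 := (lt_of_le_of_lt (Fin.zero_le _) hlt).ne'
    have hle : (σ 0).castPred h0 ≤ (σ 1).pred h1 := by
      rw [Fin.le_def, Fin.coe_castPred, Fin.val_pred]
      have := Fin.lt_def.1 hlt
      omega
    refine ⟨⟨(σ 0).castPred h0, (σ 1).pred h1⟩, by simpa using hle, ?_⟩
    refine unshuffles_ext (pairPerm_mem_unshuffles hle) hσ ?_ ?_
    · rw [pairPerm_zero, Fin.castSucc_castPred]
    · rw [pairPerm_one hle, Fin.succ_pred]

end Unshuffles

section Graded

/-! ### Graded quotients -/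

variable {K V : Type*} [Field K] [AddCommGroup V] [Module K V]

/-- `π i` kills the other pieces and fixes `𝒜 i`, which gives independence; the finite decomposition
`total` gives spanning. -/
theorem isInternal_of_projections (𝒜 : ℤ → Submodule K V) (π : ℤ → V →ₗ[K] V) (s : Finset ℤ)
    (mem : ∀ i x, π i x ∈ 𝒜 i) (same : ∀ i, ∀ x ∈ 𝒜 i, π i x = x)
    (other : ∀ i j, i ≠ j → ∀ x ∈ 𝒜 j, π i x = 0) (total : ∀ x, ∑ i ∈ s, π i x = x) :
    DirectSum.IsInternal 𝒜 := by
  rw [DirectSum.isInternal_submodule_iff_iSupIndep_and_iSup_eq_top]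
  constructor
  · intro i
    rw [Submodule.disjoint_def]
    intro x hx hx'
    have : ⨆ j, ⨆ (_ : j ≠ i), 𝒜 j ≤ LinearMap.ker (π i) :=
      iSup₂_le fun j hj y hy => other i j hj.symm y hy
    rw [← same i x hx]
    exact this hx'
  · rw [eq_top_iff]
    intro x _
    rw [← total x]
    exact Submodule.sum_mem _ fun i _ => Submodule.mem_iSup_of_mem i (mem i x)

/-- Stability of `N` under the projections makes it homogeneous, so the projections descend and the
preceding criterion applies. -/
theorem isInternal_map_mkQ (𝒜 : ℤ → Submodule K V) (π : ℤ → V →ₗ[K] V) (s : Finset ℤ)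
    (mem : ∀ i x, π i x ∈ 𝒜 i) (same : ∀ i, ∀ x ∈ 𝒜 i, π i x = x)
    (other : ∀ i j, i ≠ j → ∀ x ∈ 𝒜 j, π i x = 0) (total : ∀ x, ∑ i ∈ s, π i x = x)
    (N : Submodule K V) (hN : ∀ i, ∀ x ∈ N, π i x ∈ N) :
    DirectSum.IsInternal fun i => (𝒜 i).map N.mkQ := by
  refine isInternal_of_projections _ (fun i => N.mapQ N (π i) (hN i)) s ?_ ?_ ?_ ?_
  · intro i x
    obtain ⟨x, rfl⟩ := N.mkQ_surjective x
    exact ⟨π i x, mem i x, rfl⟩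
  · rintro i _ ⟨x, hx, rfl⟩
    exact congrArg N.mkQ (same i x hx)
  · rintro i j hij _ ⟨x, hx, rfl⟩
    exact (congrArg N.mkQ (other i j hij x hx)).trans (map_zero _)
  · intro x
    obtain ⟨x, rfl⟩ := N.mkQ_surjective x
    refine Eq.trans ?_ (congrArg N.mkQ (total x))
    rw [map_sum]
    rfl

/-- The arguments are exchanged one at a time; each exchange changes `f` by a value with one
argument in `N`. -/
theorem mkQ_eq_of_sub_mem (N : Submodule K V) {n : ℕ}
    (f : MultilinearMap K (fun _ : Fin n => V) V) (hf : ∀ x i, x i ∈ N → f x ∈ N)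
    {x y : Fin n → V} (hxy : ∀ i, N.mkQ (x i) = N.mkQ (y i)) : N.mkQ (f x) = N.mkQ (f y) := by
  have : ∀ s : Finset (Fin n), N.mkQ (f (s.piecewise x y)) = N.mkQ (f y) := by
    intro s
    induction s using Finset.induction_on with
    | empty => simp
    | insert a s ha ih =>
      rw [← ih, ← sub_eq_zero, ← map_sub, Submodule.mkQ_apply, Submodule.Quotient.mk_eq_zero,
        Finset.piecewise_insert]
      have e : s.piecewise x y = Function.update (s.piecewise x y) a (y a) := by
        rw [← Finset.piecewise_eq_of_notMem s x y ha, Function.update_eq_self]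
      conv in f (s.piecewise x y) => rw [e]
      rw [← MultilinearMap.map_update_sub]
      refine hf _ a ?_
      rw [Function.update_self, ← Submodule.Quotient.mk_eq_zero, ← Submodule.mkQ_apply, map_sub,
        hxy, sub_self]
  simpa using this Finset.univ

/-- A multilinear map that takes values in `N` as soon as one argument lies in `N` descends to
the quotient by `N`. -/
def quotientMultilinear (N : Submodule K V) {n : ℕ} (f : MultilinearMap K (fun _ : Fin n => V) V)
    (hf : ∀ x i, x i ∈ N → f x ∈ N) : MultilinearMap K (fun _ : Fin n => V ⧸ N) (V ⧸ N) :=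
  have hs : ∀ a, N.mkQ (Function.surjInv N.mkQ_surjective a) = a :=
    Function.surjInv_eq N.mkQ_surjective
  -- The chosen representatives are not linear in the class. This lets the representative in slot
  -- `i` be replaced by any other lift, such as a sum or multiple of chosen ones.
  have e : ∀ (x : Fin n → V ⧸ N) (i : Fin n) (c : V ⧸ N) (c' : V), N.mkQ c' = c →
      N.mkQ (f fun j => Function.surjInv N.mkQ_surjective (Function.update x i c j)) =
        N.mkQ (f (Function.update (fun j => Function.surjInv N.mkQ_surjective (x j)) i c')) := by
    rintro x i _ c' rfl
    refine mkQ_eq_of_sub_mem N f hf fun j => ?_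
    rw [hs]
    rcases eq_or_ne j i with rfl | h
    · simp
    · rw [Function.update_of_ne h, Function.update_of_ne h, hs]
  { toFun := fun x => N.mkQ (f fun i => Function.surjInv N.mkQ_surjective (x i))
    map_update_add' := by
      intro inst x i a b
      rw [Subsingleton.elim inst (instDecidableEqFin _)]
      rw [e x i (a + b) (Function.surjInv N.mkQ_surjective a + Function.surjInv N.mkQ_surjective b)
        (by rw [map_add, hs, hs]), e x i a _ (hs a), e x i b _ (hs b),
        MultilinearMap.map_update_add, map_add]
    map_update_smul' := by
      intro inst x i c a
      rw [Subsingleton.elim inst (instDecidableEqFin _)]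
      rw [e x i (c • a) (c • Function.surjInv N.mkQ_surjective a) (by rw [map_smul, hs]),
        e x i a _ (hs a), MultilinearMap.map_update_smul, map_smul] }

theorem quotientMultilinear_mk (N : Submodule K V) {n : ℕ}
    (f : MultilinearMap K (fun _ : Fin n => V) V) (hf : ∀ x i, x i ∈ N → f x ∈ N)
    (x : Fin n → V) :
    quotientMultilinear N f hf (fun i => N.mkQ (x i)) = N.mkQ (f x) :=
  mkQ_eq_of_sub_mem N f hf fun _ => Function.surjInv_eq N.mkQ_surjective _

/-- The quotient of an `L_∞`-algebra by a homogeneous ideal. -/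
def LInfinityAlgebra.quotient {𝒜 : ℤ → Submodule K V} (Λ : LInfinityAlgebra K 𝒜)
    (N : Submodule K V) (hN : ∀ (n : ℕ) x i, x i ∈ N → Λ.l n x ∈ N)
    (internal : DirectSum.IsInternal fun i => (𝒜 i).map N.mkQ) :
    LInfinityAlgebra K fun i => (𝒜 i).map N.mkQ where
  isInternal := internal
  l n := quotientMultilinear N (Λ.l n) (hN n)
  l_zero := by
    ext x
    obtain rfl : x = fun i => N.mkQ 0 := Subsingleton.elim _ _
    rw [quotientMultilinear_mk, Λ.l_zero]
    rfl
  l_mem n deg x hx := by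
    choose y hy hyx using hx
    obtain rfl : (fun i => N.mkQ (y i)) = x := funext hyx
    rw [quotientMultilinear_mk]
    exact ⟨_, Λ.l_mem n deg y hy, rfl⟩
  skew n deg x hx σ := by
    choose y hy hyx using hx
    obtain rfl : (fun i => N.mkQ (y i)) = x := funext hyx
    rw [quotientMultilinear_mk N _ _ (fun i => y (σ i)), quotientMultilinear_mk, Λ.skew n deg y hy]
    exact map_zsmul _ _ _
  jacobi n deg x hx := by
    choose y hy hyx using hx
    obtain rfl : (fun i => N.mkQ (y i)) = x := funext hyx
    refine Eq.trans ?_ ((congrArg N.mkQ (Λ.jacobi n deg y hy)).trans (map_zero _))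
    rw [map_sum]
    refine Finset.sum_congr rfl fun i _ => ?_
    rw [map_sum]
    refine Finset.sum_congr rfl fun σ _ => ?_
    refine Eq.trans ?_ (map_zsmul N.mkQ _ _).symm
    rw [quotientMultilinear_mk N _ _ (fun a => y (σ ⟨a, _⟩))]
    congr 1
    refine Eq.trans (congrArg (quotientMultilinear N _ (hN _)) ?_)
      (quotientMultilinear_mk N _ (hN _) _)
    funext b
    exact Fin.cases rfl (fun _ => rfl) b

end Graded

end

end ConstraintReduction

namespace ConstraintReduction

noncomputable section

section Observables

variable {K : Type*} [Field K] [CharZero K] {R : Type*} [CommRing R] [Algebra K R] {p : ℕ}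

/-! ### The brackets of the observables -/

theorem obsBracket_one_fst_succ (ω : Form K R (p + 2)) (x : Fin 1 → Amb K R p) (m : Fin p) :
    (obsBracket ω 1 x).1 m.succ = ceDiff ((x 0).1 m.castSucc) := rfl

theorem obsBracket_one_snd (ω : Form K R (p + 2)) (x : Fin 1 → Amb K R p) :
    (obsBracket ω 1 x).2 = 0 := rfl

/-- The condition on the degree in `obsBracket` is automatic for `multiIns`, which vanishes in every
other degree; the formula thus holds uniformly in `m`. -/
theorem obsBracket_fst (ω : Form K R (p + 2)) (j : ℕ) (x : Fin (j + 2) → Amb K R p)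
    (m : Fin (p + 1)) : (obsBracket ω (j + 2) x).1 m =
      (-1 : ℤ) ^ (j + 3) • multiIns (Pi.single (p + 2) ω) (j + 2) (fun i => (x i).2) m := by
  by_cases h : (m : ℕ) + (j + 2) = p + 2
  · rw [← single_domDomCongr h.symm ω, multiIns_single_eq_iterContr]
    exact dif_pos h
  · rw [multiIns_single_of_ne _ _ h, smul_zero]
    exact dif_neg h

theorem obsBracket_snd (ω : Form K R (p + 2)) (j : ℕ) (x : Fin (j + 2) → Amb K R p) :
    (obsBracket ω (j + 2) x).2 = if j = 0 then ⁅(x 0).2, (x 1).2⁆ else 0 := rfl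

theorem obsBracket_two_snd (ω : Form K R (p + 2)) (x : Fin 2 → Amb K R p) :
    (obsBracket ω 2 x).2 = ⁅(x 0).2, (x 1).2⁆ := rfl

theorem obsBracket_snd_of_ne (ω : Form K R (p + 2)) {n : ℕ} (hn : n ≠ 2)
    (x : Fin n → Amb K R p) : (obsBracket ω n x).2 = 0 :=
  match n, hn, x with
  | 0, _, _ => rfl
  | 1, _, _ => rfl
  | j + 2, hn, x => (obsBracket_snd ω j x).trans (if_neg (by omega))

/-- With at least two arguments only the derivation parts enter, and linearly. This is how the
brackets vanish on arguments of nonzero degree. -/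
theorem obsBracket_eq_zero (ω : Form K R (p + 2)) {n : ℕ} (hn : 2 ≤ n) {x : Fin n → Amb K R p}
    (i : Fin n) (hi : (x i).2 = 0) : obsBracket ω n x = 0 := by
  obtain ⟨j, rfl⟩ : ∃ j, n = j + 2 := ⟨n - 2, by omega⟩
  refine Prod.ext (funext fun m => ?_) ?_
  · rw [obsBracket_fst, (multiIns _ _).map_coord_zero i hi, Pi.zero_apply, smul_zero]
    rfl
  · rw [obsBracket_snd]
    split_ifs with h
    · subst h
      revert i
      refine fun i => Fin.cases (fun hi => ?_) (fun i => ?_) i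
      · rw [hi, zero_lie]; rfl
      · intro hi
        rw [Subsingleton.elim (α := Fin 1) i 0] at hi
        rw [show (1 : Fin 2) = Fin.succ 0 from rfl, hi, lie_zero]; rfl
    · rfl

/-- The brackets of the observables as multilinear maps on the ambient space. -/
def obsMultilinear (ω : Form K R (p + 2)) : ∀ n : ℕ,
    MultilinearMap K (fun _ : Fin n => Amb K R p) (Amb K R p)
  | 0 => 0
  | 1 =>
    { toFun := obsBracket ω 1
      map_update_add' := by
        intro inst x i a b
        rw [Subsingleton.elim inst (instDecidableEqFin _), Subsingleton.elim i 0]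
        refine Prod.ext (funext fun m => ?_) (add_zero 0).symm
        refine Fin.cases (add_zero 0).symm (fun m => ?_) m
        rw [Prod.fst_add, Pi.add_apply]
        simp only [obsBracket_one_fst_succ, Function.update_self]
        exact map_add _ _ _
      map_update_smul' := by
        intro inst x i c a
        rw [Subsingleton.elim inst (instDecidableEqFin _), Subsingleton.elim i 0]
        refine Prod.ext (funext fun m => ?_) (smul_zero c).symm
        refine Fin.cases (smul_zero c).symm (fun m => ?_) m
        rw [Prod.smul_fst, Pi.smul_apply]
        simp only [obsBracket_one_fst_succ, Function.update_self]
        exact (ceDiff (n := m)).map_smul c _ }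
  | j + 2 =>
    have e : ∀ (x : Fin (j + 2) → Amb K R p) (i : Fin (j + 2)) (a : Amb K R p),
        (fun k => (Function.update x i a k).2) = Function.update (fun k => (x k).2) i a.2 :=
      fun x i a => funext fun k => Function.apply_update (fun _ => Prod.snd) x i a k
    have e' : ∀ (x : Fin 2 → Amb K R p) (i : Fin 2) (a : Amb K R p) (k : Fin 2),
        (Function.update x i a k).2 = Function.update (fun k => (x k).2) i a.2 k :=
      fun x i a k => Function.apply_update (fun _ => Prod.snd) x i a k
    { toFun := obsBracket ω (j + 2)
      map_update_add' := by
        intro inst x i a b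
        rw [Subsingleton.elim inst (instDecidableEqFin _)]
        refine Prod.ext (funext fun m => ?_) ?_
        · rw [Prod.fst_add, Pi.add_apply, obsBracket_fst, obsBracket_fst, obsBracket_fst, e, e, e,
            Prod.snd_add, (multiIns _ _).map_update_add, Pi.add_apply, smul_add]
        · rw [Prod.snd_add, obsBracket_snd, obsBracket_snd, obsBracket_snd]
          split_ifs with h
          · subst h
            simp only [e']
            fin_cases i <;> simp
          · exact (add_zero 0).symm
      map_update_smul' := by
        intro inst x i c a
        rw [Subsingleton.elim inst (instDecidableEqFin _)]
        refine Prod.ext (funext fun m => ?_) ?_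
        -- `multiIns` is multilinear over `R`, so the scalar of `K` is passed through `algebraMap`.
        · rw [Prod.smul_fst, Pi.smul_apply, obsBracket_fst, obsBracket_fst, e, e,
            Prod.smul_snd, ← algebraMap_smul R c a.2, (multiIns _ _).map_update_smul,
            Pi.smul_apply, algebraMap_smul, smul_comm]
        · rw [Prod.smul_snd, obsBracket_snd, obsBracket_snd]
          split_ifs with h
          · subst h
            simp only [e']
            fin_cases i <;> simp
          · exact (smul_zero c).symm }

theorem obsMultilinear_apply (ω : Form K R (p + 2)) : ∀ {n : ℕ} (x : Fin n → Amb K R p),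
    obsMultilinear ω n x = obsBracket ω n x
  | 0, _ => rfl
  | 1, _ => rfl
  | _ + 2, _ => rfl

/-- The projection of the ambient space to its part of degree `i`. -/
def ambProj (p : ℕ) (i : ℤ) : Amb K R p →ₗ[K] Amb K R p where
  toFun x := (fun m => if (m : ℤ) = p + i then x.1 m else 0, if i = 0 then x.2 else 0)
  map_add' x y := by
    refine Prod.ext (funext fun m => ?_) ?_
    · simp only [Prod.fst_add, Pi.add_apply]
      split_ifs <;> simp
    · simp only [Prod.snd_add]
      split_ifs <;> simp
  map_smul' c x := by
    refine Prod.ext (funext fun m => ?_) ?_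
    · simp only [Prod.smul_fst, Pi.smul_apply, RingHom.id_apply]
      split_ifs <;> simp
    · simp only [Prod.smul_snd, RingHom.id_apply]
      split_ifs <;> simp

theorem ambProj_fst (i : ℤ) (x : Amb K R p) (m : Fin (p + 1)) :
    (ambProj p i x).1 m = if (m : ℤ) = p + i then x.1 m else 0 := rfl

theorem ambProj_snd (i : ℤ) (x : Amb K R p) :
    (ambProj p i x).2 = if i = 0 then x.2 else 0 := rfl

theorem ambProj_mem (i : ℤ) (x : Amb K R p) : ambProj p i x ∈ ambGrade (K := K) (R := R) p i :=
  ⟨fun _ hm => if_neg hm, fun hi => if_neg hi⟩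

theorem ambProj_same (i : ℤ) (x : Amb K R p) (hx : x ∈ ambGrade (K := K) (R := R) p i) :
    ambProj p i x = x := by
  refine Prod.ext (funext fun m => ?_) ?_
  · rw [ambProj_fst]
    split_ifs with h
    · rfl
    · exact (hx.1 m h).symm
  · rw [ambProj_snd]
    split_ifs with h
    · rfl
    · exact (hx.2 h).symm

theorem ambProj_other (i j : ℤ) (hij : i ≠ j) (x : Amb K R p)
    (hx : x ∈ ambGrade (K := K) (R := R) p j) : ambProj p i x = 0 := by
  refine Prod.ext (funext fun m => ?_) ?_
  · rw [ambProj_fst]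
    split_ifs with h
    · exact hx.1 m (by omega)
    · rfl
  · rw [ambProj_snd]
    split_ifs with h
    · exact hx.2 (by omega)
    · rfl

theorem sum_ambProj (x : Amb K R p) :
    ∑ i ∈ Finset.Icc (-(p : ℤ)) 0, ambProj p i x = x := by
  refine Prod.ext (funext fun m => ?_) ?_
  · rw [Prod.fst_sum, Finset.sum_apply, Finset.sum_eq_single_of_mem ((m : ℤ) - p)]
    · rw [ambProj_fst, if_pos (by ring)]
    · have := m.2
      rw [Finset.mem_Icc]
      omega
    · intro i _ hi
      rw [ambProj_fst, if_neg (by omega)]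
  · rw [Prod.snd_sum, Finset.sum_eq_single_of_mem 0]
    · rw [ambProj_snd, if_pos rfl]
    · simp
    · intro i _ hi
      rw [ambProj_snd, if_neg hi]

/-- On arguments of degree zero, the form degree `m` with `m + n = p + 2` is exactly grade `2 - n`,
and a derivation part occurs only for `n = 2`. -/
theorem obsBracket_mem_ambGrade (ω : Form K R (p + 2)) {n : ℕ} (deg : Fin n → ℤ)
    (x : Fin n → Amb K R p) (hx : ∀ i, x i ∈ ambGrade (K := K) (R := R) p (deg i)) :
    obsBracket ω n x ∈ ambGrade (K := K) (R := R) p (∑ i, deg i + 2 - n) := by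
  match n, deg, x, hx with
  | 0, _, _, _ => exact zero_mem _
  | 1, deg, x, hx =>
    refine ⟨fun m hm => ?_, fun _ => rfl⟩
    revert hm
    refine Fin.cases (fun _ => rfl) (fun m hm => ?_) m
    rw [obsBracket_one_fst_succ, (hx 0).1 _ ?_, map_zero]
    simp only [Fin.val_succ, Fin.val_castSucc, Finset.univ_unique, Finset.sum_singleton] at hm ⊢
    intro h
    apply hm
    push_cast
    rw [h, show (default : Fin 1) = 0 from rfl]
    ring
  | j + 2, deg, x, hx =>
    by_cases h : ∀ i, deg i = 0
    · simp only [h, Finset.sum_const_zero]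
      refine ⟨fun m hm => ?_, fun hj => ?_⟩
      · rw [obsBracket_fst, multiIns_single_of_ne, smul_zero]
        intro h'
        apply hm
        push_cast
        omega
      · rw [obsBracket_snd, if_neg]
        rintro rfl
        exact hj (by simp)
    · obtain ⟨i, hi⟩ := not_forall.1 h
      rw [obsBracket_eq_zero ω (by omega) i ((hx i).2 hi)]
      exact zero_mem _

theorem obsBracket_perm (ω : Form K R (p + 2)) {n : ℕ} (deg : Fin n → ℤ)
    (x : Fin n → Amb K R p) (hx : ∀ i, x i ∈ ambGrade (K := K) (R := R) p (deg i))
    (σ : Equiv.Perm (Fin n)) :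
    obsBracket ω n (fun i => x (σ i)) = skewKoszul σ deg • obsBracket ω n x := by
  match n, deg, x, hx, σ with
  | 0, deg, x, hx, σ =>
    exact (smul_zero _).symm
  | 1, deg, x, hx, σ =>
    obtain rfl : σ = 1 := Subsingleton.elim _ _
    rw [skewKoszul_one, one_smul]
    rfl
  | j + 2, deg, x, hx, σ =>
    by_cases h : ∀ i, deg i = 0
    · rw [skewKoszul_eq_sign σ h]
      refine Prod.ext (funext fun m => ?_) ?_
      · rw [obsBracket_fst, Prod.smul_fst, Pi.smul_apply, obsBracket_fst]
        rw [show (fun i => (x (σ i)).2) = (fun i => (x i).2) ∘ σ from rfl,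
          AlternatingMap.map_perm, Pi.smul_apply, smul_comm]
      · rw [Prod.smul_snd, obsBracket_snd, obsBracket_snd]
        split_ifs with hj
        · subst hj
          rcases eq_or_ne σ 1 with rfl | hσ
          · simp
          · obtain rfl : σ = Equiv.swap 0 1 := by
              revert σ; decide
            simp [Equiv.Perm.sign_swap (show (0 : Fin 2) ≠ 1 by decide)]
        · exact (smul_zero _).symm
    · obtain ⟨i, hi⟩ := not_forall.1 h
      rw [obsBracket_eq_zero ω (by omega) i ((hx i).2 hi), smul_zero,
        obsBracket_eq_zero ω (by omega) (σ.symm i)]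
      rw [Equiv.apply_symm_apply]
      exact (hx i).2 hi

end Observables

end

end ConstraintReduction

namespace ConstraintReduction

noncomputable section

/-! ### The generalized Jacobi identities -/

section Jacobi

variable {K : Type*} [Field K] [CharZero K] {R : Type*} [CommRing R] [Algebra K R] {p : ℕ}

theorem diffT_single {N : ℕ} {ω : Form K R N} (hω : ceDiff ω = 0) :
    diffT (Pi.single N ω : TotalForm K R) = 0 := by
  funext m
  cases m with
  | zero => rfl
  | succ m =>
    rw [diffT_succ]
    rcases eq_or_ne m N with rfl | h
    · rw [Pi.single_eq_same, hω]; rfl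
    · rw [Pi.single_eq_of_ne h, map_zero]; rfl

theorem lieT_single {N : ℕ} {ω : Form K R N} {X : Der K R} (hω : lieDer X ω = 0) :
    lieT X (Pi.single N ω : TotalForm K R) = 0 := by
  funext m
  rw [lieT_apply]
  rcases eq_or_ne m N with rfl | h
  · rw [Pi.single_eq_same, hω]; rfl
  · rw [Pi.single_eq_of_ne h, map_zero]; rfl

theorem mem_ham_iff {ω : Form K R (p + 2)} {x : Amb K R p} :
    x ∈ ham ω ↔ ins x.2 ω = -ceDiff (x.1 (Fin.last p)) := Iff.rfl

theorem lieDer_of_mem_ham {ω : Form K R (p + 2)} (hω : ceDiff ω = 0) {x : Amb K R p}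
    (hx : x ∈ ham ω) : lieDer x.2 ω = 0 := by
  rw [lieDer_succ, hω, map_zero, zero_add, mem_ham_iff.1 hx, map_neg, ceDiff_ceDiff, neg_zero]

theorem obsBracket_one_eq_zero (ω : Form K R (p + 2)) {x : Fin 1 → Amb K R p}
    (h : ∀ m : Fin p, (x 0).1 m.castSucc = 0) : obsBracket ω 1 x = 0 := by
  refine Prod.ext (funext fun m => ?_) rfl
  refine Fin.cases rfl (fun m => ?_) m
  rw [obsBracket_one_fst_succ, h, map_zero]
  rfl

/-- The binary bracket has a form only in top degree `p`, which `l_1` ignores; hence `l_1 ∘ l_2 =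
0`. -/
theorem obsBracket_two_fst_castSucc (ω : Form K R (p + 2)) (x : Fin 2 → Amb K R p) (m : Fin p) :
    (obsBracket ω 2 x).1 m.castSucc = 0 := by
  rw [obsBracket_fst, multiIns_single_of_ne, smul_zero]
  have := m.2
  simp
  omega

theorem obsBracket_one_obsBracket (ω : Form K R (p + 2)) (j : ℕ) (x : Fin (j + 3) → Amb K R p)
    (m : Fin (p + 1)) :
    (obsBracket ω 1 fun _ => obsBracket ω (j + 3) x).1 m = (-1 : ℤ) ^ (j + 4) •
      diffT (multiIns (Pi.single (p + 2) ω) (j + 3) fun i => (x i).2) m := by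
  refine Fin.cases (smul_zero _).symm (fun m => ?_) m
  rw [obsBracket_one_fst_succ, obsBracket_fst ω (j + 1), map_zsmul]
  rfl

theorem obsBracket_one_obsBracket_one (ω : Form K R (p + 2)) (x : Fin 1 → Amb K R p) :
    (obsBracket ω 1 fun _ => obsBracket ω 1 x) = 0 := by
  refine Prod.ext (funext fun m => Fin.cases rfl (fun m => ?_) m) rfl
  obtain ⟨q, rfl⟩ : ∃ q, p = q + 1 := ⟨p - 1, by have := m.pos; omega⟩
  -- In form degree one, `d` is applied to the zero that `l_1` places in degree zero; above that, `d
  -- ∘ d = 0`.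
  refine Fin.cases ?_ (fun m => ?_) m
  · exact map_zero ceDiff
  · exact ceDiff_ceDiff _

theorem obsBracket_vecCons_of_eq_zero (ω : Form K R (p + 2)) {r : ℕ} (hr : r = 0)
    (a : Amb K R p) (b : Fin r → Amb K R p) :
    obsBracket ω (r + 1) (Matrix.vecCons a b) = obsBracket ω 1 fun _ => a := by
  subst hr
  exact congrArg (obsBracket ω 1) (funext fun i => by rw [Subsingleton.elim i 0]; rfl)

/-- The generalized Jacobi identity for `j + 3` observables. -/
theorem obsBracket_jacobi_aux {ω : Form K R (p + 2)} (hω : ceDiff ω = 0) {j : ℕ}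
    {x : Fin (j + 3) → Amb K R p} (hx : ∀ i, x i ∈ ham ω) :
    (∑ i : Fin (j + 2), ∑ k ∈ Finset.Ici i, (-1 : ℤ) ^ (i + k : ℕ) •
      obsBracket ω (j + 2) (Matrix.vecCons (obsBracket ω 2 ![x i.castSucc, x k.succ])
        (k.removeNth (i.castSucc.removeNth x)))) +
      (obsBracket ω 1 fun _ => obsBracket ω (j + 3) x) = 0 := by
  refine Prod.ext (funext fun m => ?_) ?_
  · rw [Prod.fst_add, Pi.add_apply, obsBracket_one_obsBracket, diffT_multiIns (diffT_single hω) _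
      (fun i => lieT_single (lieDer_of_mem_ham hω (hx i)))]
    simp only [Prod.fst_sum, Finset.sum_apply, Finset.smul_sum, Prod.smul_fst, Pi.smul_apply]
    rw [← Finset.sum_add_distrib]
    refine Finset.sum_eq_zero fun i _ => ?_
    rw [← Finset.sum_add_distrib]
    refine Finset.sum_eq_zero fun k _ => ?_
    rw [obsBracket_fst]
    have e : (fun l => (Matrix.vecCons (obsBracket ω 2 ![x i.castSucc, x k.succ])
        (k.removeNth (i.castSucc.removeNth x)) l).2) =
        Matrix.vecCons ⁅(x i.castSucc).2, (x k.succ).2⁆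
          (k.removeNth (i.castSucc.removeNth fun l => (x l).2)) := by
      funext l
      exact Fin.cases rfl (fun _ => rfl) l
    rw [e, smul_smul, smul_smul]
    -- The terms cancel in pairs because the signs of `l_{j+2}` and `l_{j+3}` are opposite.
    refine (add_smul _ _ _).symm.trans ?_
    rw [show (-1 : ℤ) ^ (i + k : ℕ) * (-1) ^ (j + 3) + (-1) ^ (j + 4) * (-1) ^ (i + k : ℕ) = 0 by
      ring, zero_smul]
  · rw [Prod.snd_add, obsBracket_one_snd, add_zero]
    simp only [Prod.snd_sum, Prod.smul_snd]
    -- A derivation part survives only for three arguments, where the claim is the Jacobi identity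
    -- of the commutator.
    cases j with
    | zero =>
      have h0 : Finset.Ici (0 : Fin 2) = {0, 1} := by decide
      have h1 : Finset.Ici (1 : Fin 2) = {1} := by decide
      rw [Fin.sum_univ_two, h0, h1, Finset.sum_pair (by decide), Finset.sum_singleton]
      simp only [obsBracket_snd, if_true]
      have hr : ∀ i k : Fin 2, (Matrix.vecCons (obsBracket ω 2 ![x i.castSucc, x k.succ])
        (k.removeNth (i.castSucc.removeNth x)) 1) = x (i.castSucc.succAbove (k.succAbove 0)) :=
        fun i k => rfl
      simp only [Matrix.cons_val_zero, obsBracket_two_snd, Matrix.cons_val_one, hr]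
      have e1 : ((0 : Fin 2).castSucc.succAbove ((0 : Fin 2).succAbove (0 : Fin 1))) = 2 := by decide
      have e2 : ((0 : Fin 2).castSucc.succAbove ((1 : Fin 2).succAbove (0 : Fin 1))) = 1 := by decide
      have e3 : ((1 : Fin 2).castSucc.succAbove ((1 : Fin 2).succAbove (0 : Fin 1))) = 0 := by decide
      rw [e1, e2, e3]
      have f1 : (0 : Fin 2).castSucc = (0 : Fin 3) := rfl
      have f2 : (1 : Fin 2).castSucc = (1 : Fin 3) := rfl
      have f3 : (0 : Fin 2).succ = (1 : Fin 3) := rfl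
      have f4 : (1 : Fin 2).succ = (2 : Fin 3) := rfl
      rw [f1, f2, f3, f4]
      rw [lie_lie, ← lie_skew (x 1).2 ⁅(x 0).2, (x 2).2⁆, ← lie_skew (x 0).2 ⁅(x 1).2, (x 2).2⁆]
      norm_num
    | succ j =>
      refine Finset.sum_eq_zero fun i _ => Finset.sum_eq_zero fun k _ => ?_
      rw [obsBracket_snd_of_ne ω (by omega), smul_zero]

/-- The observables of a closed form satisfy the Jacobi identities of an `L_∞`-algebra. -/
theorem obsBracket_jacobi {ω : Form K R (p + 2)} (hω : ceDiff ω = 0) {n : ℕ} (deg : Fin n → ℤ)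
    {x : Fin n → Amb K R p} (hx : ∀ i, x i ∈ ambGrade (K := K) (R := R) p (deg i))
    (hx' : ∀ i, x i ∈ ham ω) :
    ∑ i : Fin n, ∑ σ ∈ unshuffles n (i + 1),
      ((-1 : ℤˣ) ^ (((i : ℕ) + 1) * (n - (i + 1))) * skewKoszul σ deg) •
        obsBracket ω (n - (i + 1) + 1) (Matrix.vecCons
          (obsBracket ω (i + 1) fun a => x (σ ⟨a, by omega⟩))
          (fun b : Fin (n - (i + 1)) => x (σ ⟨i + 1 + b, by omega⟩))) = 0 := by
  -- Unless the inner bracket is binary it has no derivation part, and then an outer bracket of at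
  -- least two arguments vanishes; the outer one is unary exactly for `i + 1 = n`.
  have gen : ∀ i : Fin n, (i : ℕ) ≠ 1 → (i : ℕ) + 1 ≠ n → ∀ σ : Equiv.Perm (Fin n),
      obsBracket ω (n - (i + 1) + 1) (Matrix.vecCons
          (obsBracket ω (i + 1) fun a => x (σ ⟨a, by omega⟩))
          (fun b : Fin (n - (i + 1)) => x (σ ⟨i + 1 + b, by omega⟩))) = 0 := by
    intro i hi hi' σ
    have := i.2
    exact obsBracket_eq_zero ω (by omega) 0 (obsBracket_snd_of_ne ω (by omega) _)
  match n, deg, x, hx, hx', gen with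
  | 0, _, _, _, _, _ => rfl
  | 1, deg, x, hx, _, _ =>
    refine Finset.sum_eq_zero fun i _ => Finset.sum_eq_zero fun σ _ => ?_
    obtain rfl : i = 0 := Subsingleton.elim _ _
    refine smul_eq_zero_of_right _ ?_
    exact (obsBracket_vecCons_of_eq_zero ω (r := 1 - (((0 : Fin 1) : ℕ) + 1)) rfl _ _).trans
      (obsBracket_one_obsBracket_one ω _)
  | 2, deg, x, hx, _, gen =>
    refine Finset.sum_eq_zero fun i _ => Finset.sum_eq_zero fun σ _ => ?_
    refine smul_eq_zero_of_right _ ?_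
    by_cases hi : i = 1
    · subst hi
      exact obsBracket_one_eq_zero ω fun m => obsBracket_two_fst_castSucc ω _ m
    · have := i.2
      exact gen i (fun h => hi (Fin.ext h)) (by omega) σ
  | j + 3, deg, x, hx, hx', gen =>
    rw [Finset.sum_eq_add_of_mem (⟨1, by omega⟩ : Fin (j + 3)) (Fin.last (j + 2))
      (Finset.mem_univ _) (Finset.mem_univ _) (by simp [Fin.ext_iff])]
    swap
    · rintro i - ⟨h1, h2⟩
      refine Finset.sum_eq_zero fun σ _ => smul_eq_zero_of_right _ (gen i ?_ ?_ σ)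
      · exact fun h => h1 (Fin.ext h)
      · exact fun h => h2 (Fin.ext (by simpa using h))
    have last : ∑ σ ∈ unshuffles (j + 3) (Fin.last (j + 2) + 1),
        ((-1 : ℤˣ) ^ (((Fin.last (j + 2) : ℕ) + 1) * (j + 3 - (Fin.last (j + 2) + 1))) *
            skewKoszul σ deg) •
          obsBracket ω (j + 3 - (Fin.last (j + 2) + 1) + 1) (Matrix.vecCons
            (obsBracket ω (Fin.last (j + 2) + 1) fun a => x (σ ⟨a, by omega⟩))
            (fun b : Fin (j + 3 - (Fin.last (j + 2) + 1)) =>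
              x (σ ⟨Fin.last (j + 2) + 1 + b, by omega⟩))) =
        obsBracket ω 1 fun _ => obsBracket ω (j + 3) x := by
      have hr : j + 3 - ((Fin.last (j + 2) : ℕ) + 1) = 0 := by simp
      rw [show unshuffles (j + 3) (Fin.last (j + 2) + 1) = {1} from unshuffles_self (j + 3),
        Finset.sum_singleton, skewKoszul_one, obsBracket_vecCons_of_eq_zero ω hr]
      rw [show (-1 : ℤˣ) ^ (((Fin.last (j + 2) : ℕ) + 1) * (j + 3 - (Fin.last (j + 2) + 1))) = 1 by
        rw [hr, mul_zero, pow_zero], mul_one, one_smul]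
      rfl
    rw [last]
    -- If some derivation part is zero, all terms vanish. Otherwise all degrees are zero, so the
    -- Koszul sign is the signature.
    by_cases h : ∃ a, (x a).2 = 0
    · obtain ⟨a, ha⟩ := h
      rw [obsBracket_eq_zero ω (n := j + 3) (by omega) a ha]
      rw [obsBracket_one_eq_zero ω (fun _ => rfl), add_zero]
      refine Finset.sum_eq_zero fun σ _ => smul_eq_zero_of_right _ ?_
      obtain ⟨c, rfl⟩ := σ.surjective a
      -- The argument without derivation part sits either inside the inner binary bracket or at
      -- position `c - 1` of the outer one.
      rcases lt_or_ge (c : ℕ) 2 with hc | hc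
      · refine obsBracket_eq_zero ω (n := j + 2) (by omega) 0 ?_
        change (obsBracket ω 2 _).2 = 0
        rw [obsBracket_eq_zero ω le_rfl ⟨c, hc⟩ ha]
        rfl
      · refine obsBracket_eq_zero ω (n := j + 2) (by omega)
          (Fin.succ (n := j + 1) ⟨c - 2, by omega⟩) ?_
        refine Eq.trans ?_ ha
        change (x (σ ⟨1 + 1 + (c - 2), _⟩)).2 = _
        congr 4
        omega
    · have hdeg : ∀ i, deg i = 0 := fun i => by
        by_contra hi
        exact h ⟨i, (hx i).2 hi⟩
      refine Eq.trans (congrArg (· + _) ?_) (obsBracket_jacobi_aux hω hx')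
      refine (sum_unshuffles_two (n := j + 1) _).trans ?_
      refine Finset.sum_congr rfl fun i _ => Finset.sum_congr rfl fun k hk => ?_
      change ((-1 : ℤˣ) ^ (2 * (j + 1)) * skewKoszul _ deg) • obsBracket ω (j + 2) (Matrix.vecCons
        (obsBracket ω 2 fun a => x (pairPerm i k ⟨a, _⟩))
        (fun b : Fin (j + 1) => x (pairPerm i k ⟨1 + 1 + b, _⟩))) = _
      rw [skewKoszul_eq_sign _ hdeg, sign_pairPerm, Even.neg_one_pow (even_two.mul_right _), one_mul]
      have hk' : i ≤ k := by simpa using hk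
      have e1 : (fun a : Fin 2 => x (pairPerm i k ⟨a, by omega⟩)) = ![x i.castSucc, x k.succ] := by
        funext a
        fin_cases a
        · exact congrArg x (pairPerm_zero i k)
        · exact congrArg x (pairPerm_one hk')
      have e2 : (fun b : Fin (j + 1) => x (pairPerm i k ⟨1 + 1 + b, by omega⟩)) =
          k.removeNth (i.castSucc.removeNth x) := by
        funext b
        refine congrArg x (Eq.trans (congrArg (pairPerm i k) (Fin.ext ?_))
          (pairPerm_succ_succ i k b))
        simp
        omega
      rw [← e1, ← e2, Units.smul_def]
      push_cast
      rfl

end Jacobi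

end

end ConstraintReduction

namespace ConstraintReduction

noncomputable section

section SubObservables

variable {K : Type*} [Field K] [CharZero K] {R : Type*} [CommRing R] [Algebra K R] {p : ℕ}

/-! ### `L_∞`-algebras of observables -/

/-- The restriction of the degree projection to a homogeneous subspace. -/
def subProj (W : Submodule K (Amb K R p)) (hproj : ∀ i, ∀ x ∈ W, ambProj p i x ∈ W) (i : ℤ) :
    W →ₗ[K] W :=
  (ambProj p i).restrict (hproj i)

theorem subProj_mem (W : Submodule K (Amb K R p)) (hproj : ∀ i, ∀ x ∈ W, ambProj p i x ∈ W)
    (i : ℤ) (x : W) : subProj W hproj i x ∈ (ambGrade p i).comap W.subtype :=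
  ambProj_mem i (x : Amb K R p)

theorem subProj_same (W : Submodule K (Amb K R p)) (hproj : ∀ i, ∀ x ∈ W, ambProj p i x ∈ W)
    (i : ℤ) (x : W) (hx : x ∈ (ambGrade p i).comap W.subtype) : subProj W hproj i x = x :=
  Subtype.ext (ambProj_same i _ hx)

theorem subProj_other (W : Submodule K (Amb K R p)) (hproj : ∀ i, ∀ x ∈ W, ambProj p i x ∈ W)
    (i j : ℤ) (hij : i ≠ j) (x : W) (hx : x ∈ (ambGrade p j).comap W.subtype) :
    subProj W hproj i x = 0 :=
  Subtype.ext (ambProj_other i j hij _ hx)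

theorem sum_subProj (W : Submodule K (Amb K R p)) (hproj : ∀ i, ∀ x ∈ W, ambProj p i x ∈ W)
    (x : W) : ∑ i ∈ Finset.Icc (-(p : ℤ)) 0, subProj W hproj i x = x :=
  Subtype.ext ((Submodule.coe_sum W _ _).trans (sum_ambProj (x : Amb K R p)))

/-- The `L_∞`-algebra structure on a homogeneous space of observables that is stable under the
brackets. -/
def obsLInfinity {ω : Form K R (p + 2)} (hω : ceDiff ω = 0) (W : Submodule K (Amb K R p))
    (hW : W ≤ ham ω) (hproj : ∀ i, ∀ x ∈ W, ambProj p i x ∈ W)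
    (hstable : ∀ (n : ℕ) (x : Fin n → Amb K R p), (∀ i, x i ∈ W) → obsBracket ω n x ∈ W) :
    LInfinityAlgebra K fun i => (ambGrade p i).comap W.subtype where
  isInternal := isInternal_of_projections _ (subProj W hproj) _ (subProj_mem W hproj)
    (subProj_same W hproj) (subProj_other W hproj) (sum_subProj W hproj)
  l n := ((obsMultilinear ω n).compLinearMap fun _ => W.subtype).codRestrict W fun x => by
    rw [MultilinearMap.compLinearMap_apply, obsMultilinear_apply]
    exact hstable n _ fun i => (x i).2
  l_zero := rfl
  l_mem n deg x hx := by
    rw [Submodule.mem_comap]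
    change obsMultilinear ω n (fun i => (x i : Amb K R p)) ∈ _
    rw [obsMultilinear_apply]
    exact obsBracket_mem_ambGrade ω deg _ hx
  skew n deg x hx σ := by
    refine Subtype.ext ?_
    change obsMultilinear ω n (fun i => (x (σ i) : Amb K R p)) =
      skewKoszul σ deg • obsMultilinear ω n (fun i => (x i : Amb K R p))
    rw [obsMultilinear_apply, obsMultilinear_apply]
    exact obsBracket_perm ω deg (fun i => (x i : Amb K R p)) hx σ
  jacobi n deg x hx := by
    refine Subtype.ext ?_
    refine Eq.trans ?_ (obsBracket_jacobi hω deg (x := fun i => (x i : Amb K R p)) hx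
      fun i => hW (x i).2)
    rw [Submodule.coe_sum]
    refine Finset.sum_congr rfl fun i _ => ?_
    rw [Submodule.coe_sum]
    refine Finset.sum_congr rfl fun σ _ => ?_
    rw [← obsMultilinear_apply, ← obsMultilinear_apply]
    refine congrArg (fun y : Amb K R p =>
      ((-1 : ℤˣ) ^ (((i : ℕ) + 1) * (n - (i + 1))) * skewKoszul σ deg) • y) ?_
    refine congrArg (obsMultilinear ω (n - (i + 1) + 1)) ?_
    funext b
    exact Fin.cases rfl (fun _ => rfl) b

theorem obsLInfinity_l {ω : Form K R (p + 2)} (hω : ceDiff ω = 0) (W : Submodule K (Amb K R p))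
    (hW : W ≤ ham ω) (hproj : ∀ i, ∀ x ∈ W, ambProj p i x ∈ W)
    (hstable : ∀ (n : ℕ) (x : Fin n → Amb K R p), (∀ i, x i ∈ W) → obsBracket ω n x ∈ W)
    (n : ℕ) (x : Fin n → W) :
    ((obsLInfinity hω W hW hproj hstable).l n x : Amb K R p) =
      obsBracket ω n fun i => (x i : Amb K R p) :=
  obsMultilinear_apply ω _

/-- The `L_∞`-algebra structure on a quotient of spaces of observables. -/
theorem exists_quotient_lInfinity {ω : Form K R (p + 2)} (hω : ceDiff ω = 0)
    (W N : Submodule K (Amb K R p)) (hW : W ≤ ham ω)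
    (hproj : ∀ i, ∀ x ∈ W, ambProj p i x ∈ W)
    (hstable : ∀ (n : ℕ) (x : Fin n → Amb K R p), (∀ i, x i ∈ W) → obsBracket ω n x ∈ W)
    (hprojN : ∀ i, ∀ x ∈ N, ambProj p i x ∈ N)
    (hideal : ∀ (n : ℕ) (x : Fin n → Amb K R p), (∀ i, x i ∈ W) → (∃ i, x i ∈ N) →
      obsBracket ω n x ∈ N) :
    ∃ Λ : LInfinityAlgebra K fun i =>
        ((ambGrade p i).comap W.subtype).map (N.submoduleOf W).mkQ,
      ∀ (n : ℕ) (x : Fin n → W), ∃ h : obsBracket ω n (fun i => (x i : Amb K R p)) ∈ W,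
        Λ.l n (fun i => Submodule.Quotient.mk (x i)) = Submodule.Quotient.mk ⟨_, h⟩ := by
  have hN : ∀ (n : ℕ) (x : Fin n → W) (i : Fin n), x i ∈ N.submoduleOf W →
      (obsLInfinity hω W hW hproj hstable).l n x ∈ N.submoduleOf W := by
    intro n x i hi
    rw [Submodule.submoduleOf, Submodule.mem_comap, Submodule.subtype_apply, obsLInfinity_l]
    exact hideal n _ (fun i => (x i).2) ⟨i, hi⟩
  refine ⟨(obsLInfinity hω W hW hproj hstable).quotient (N.submoduleOf W) (fun n => hN n) ?_, ?_⟩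
  · exact isInternal_map_mkQ _ (subProj W hproj) _ (subProj_mem W hproj)
      (subProj_same W hproj) (subProj_other W hproj) (sum_subProj W hproj) _
      fun i x hx => hprojN i _ hx
  · intro n x
    refine ⟨hstable n _ fun i => (x i).2, ?_⟩
    exact (quotientMultilinear_mk _ _ (hN n) x).trans (congrArg Submodule.Quotient.mk
      (Subtype.ext (obsLInfinity_l hω W hW hproj hstable n x)))

end SubObservables

section Constraint

variable {K : Type*} [Field K] [CharZero K] {R : Type*} [CommRing R] [Algebra K R] {p : ℕ}

/-! ### Derivations and forms of the constraint algebra -/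

theorem smul_lie_der (X Y : Der K R) (f : R) : ⁅f • X, Y⁆ = f • ⁅X, Y⁆ - Y f • X := by
  ext r
  simp only [Derivation.commutator_apply, Derivation.sub_apply, Derivation.smul_apply,
    smul_eq_mul, Derivation.leibniz]
  ring

variable {I : Ideal R}

theorem lie_mem_derW {X Y : Der K R} (hX : X ∈ derW I) (hY : Y ∈ derW I) : ⁅X, Y⁆ ∈ derW I :=
  fun f hf => by
    rw [Derivation.commutator_apply]
    exact I.sub_mem (hX _ (hY f hf)) (hY _ (hX f hf))

theorem derN_le_derW : derN (K := K) I ≤ derW I := fun _ hX f _ => hX f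

theorem smul_top_le_derN : I • (⊤ : Submodule R (Der K R)) ≤ derN I :=
  Submodule.smul_le.2 fun _ hf _ _ _ => I.mul_mem_right _ hf

/-- The span of `F` and the derivations with coefficients in `I`. -/
abbrev spanLR (I : Ideal R) (F : Set (Der K R)) : Submodule R (Der K R) :=
  Submodule.span R F ⊔ I • ⊤

theorem spanLR_le_derW {F : Set (Der K R)} (hF : ∀ ξ ∈ F, ξ ∈ derW I) : spanLR I F ≤ derW I :=
  sup_le (Submodule.span_le.2 hF) (smul_top_le_derN.trans derN_le_derW)

/-- To show a property of elements of `spanLR I F`, it suffices to show it for multiples of elements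
of `F`, for elements of `I • ⊤` of the form `f • X`, and for sums. -/
theorem spanLR_induction {F : Set (Der K R)} {P : Der K R → Prop}
    (hF : ∀ (f : R), ∀ ξ ∈ F, P (f • ξ)) (hI : ∀ f ∈ I, ∀ X, P (f • X))
    (hadd : ∀ X Y, P X → P Y → P (X + Y)) {ξ : Der K R} (hξ : ξ ∈ spanLR I F) : P ξ := by
  have h0 : P 0 := by simpa using hI 0 I.zero_mem 0
  obtain ⟨ξ, hξ', η, hη, rfl⟩ := Submodule.mem_sup.1 hξ
  refine hadd _ _ ?_ ?_
  · exact Submodule.closure_induction (p := fun X _ => P X) h0 (fun X Y _ _ => hadd X Y) hF hξ'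
  · exact Submodule.smul_induction_on hη (fun f hf X _ => hI f hf X) fun X Y => hadd X Y

/-- By `[fξ, X] = f[ξ, X] - X(f)ξ`, brackets of `X` with `F` control those with its span; for `f ∈
I` the coefficient `X(f)` stays in `I` since `X` preserves `I`. -/
theorem lie_mem_spanLR {F : LieSubalgebra K (Der K R)}
    {X : Der K R} (hX : X ∈ derW I) (hFX : ∀ ξ ∈ F, ⁅ξ, X⁆ ∈ spanLR I (F : Set (Der K R)))
    {ξ : Der K R} (hξ : ξ ∈ spanLR I (F : Set (Der K R))) :
    ⁅ξ, X⁆ ∈ spanLR I (F : Set (Der K R)) := by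
  refine spanLR_induction (P := fun ξ => ⁅ξ, X⁆ ∈ spanLR I (F : Set (Der K R))) ?_ ?_ ?_ hξ
  · intro f ξ hξ
    rw [smul_lie_der]
    exact sub_mem (Submodule.smul_mem _ _ (hFX ξ hξ)) (Submodule.smul_mem _ _
      (Submodule.mem_sup_left (Submodule.subset_span hξ)))
  · intro f hf Y
    rw [smul_lie_der]
    exact Submodule.mem_sup_right (sub_mem (Submodule.smul_mem_smul hf trivial)
      (Submodule.smul_mem_smul (hX f hf) trivial))
  · intro Y Z hY hZ
    rw [add_lie]
    exact add_mem hY hZ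

/-- The preceding lemma is applied in each slot in turn, starting from closure of `F` under the
bracket. -/
theorem lie_mem_spanLR_of_mem {F : LieSubalgebra K (Der K R)} (hF : ∀ ξ ∈ F, ξ ∈ derW I)
    {ξ η : Der K R} (hξ : ξ ∈ spanLR I (F : Set (Der K R)))
    (hη : η ∈ spanLR I (F : Set (Der K R))) : ⁅ξ, η⁆ ∈ spanLR I (F : Set (Der K R)) := by
  refine lie_mem_spanLR (spanLR_le_derW hF hη) (fun ξ hξ => ?_) hξ
  rw [← lie_skew]
  refine neg_mem (lie_mem_spanLR (hF ξ hξ) (fun η hη => ?_) hη)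
  exact Submodule.mem_sup_left (Submodule.subset_span (F.lie_mem hη hξ))

/-- `hI` makes the span one of the competitors in the infimum; conversely each competitor contains
`F` and `I • ⊤ ≤ derN I`. -/
theorem symLR_eq_spanLR {F : LieSubalgebra K (Der K R)} (hF : ∀ ξ ∈ F, ξ ∈ derW I)
    (hI : derN (K := K) I ≤ I • ⊤) :
    symLR I (F : Set (Der K R)) = spanLR I (F : Set (Der K R)) := by
  refine le_antisymm (sInf_le ⟨?_, hI.trans le_sup_right, ?_⟩) (le_sInf ?_)
  · exact fun ξ hξ => Submodule.mem_sup_left (Submodule.subset_span hξ)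
  · exact fun X hX Y hY => lie_mem_spanLR_of_mem hF hX hY
  · rintro N ⟨hFN, hN, -⟩
    exact sup_le (Submodule.span_le.2 hFN) (smul_top_le_derN.trans hN)

theorem ins_mem_formN {n : ℕ} {α : Form K R (n + 1)} (hα : α ∈ formN I (n + 1)) {X : Der K R}
    (hX : X ∈ derW I) : ins X α ∈ formN I n := fun v hv => by
  rw [ins_apply]
  exact hα _ fun i => Fin.cases hX hv i

theorem contr_mem_formN {n : ℕ} {α : Form K R n} (hα : α ∈ formN I n) {X : Der K R}
    (hX : X ∈ derW I) : contr X α ∈ formN I (n - 1) := by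
  cases n with
  | zero => exact zero_mem _
  | succ n => exact ins_mem_formN hα hX

/-- Each term of `dα` stays in `I`: derivations in `derW I` preserve `I`, and their brackets are
again in `derW I`. -/
theorem ceDiff_mem_formN {n : ℕ} {α : Form K R n} (hα : α ∈ formN I n) :
    ceDiff α ∈ formN I (n + 1) := by
  intro v hv
  rw [ceDiff_apply]
  have h1 : ∀ i : Fin (n + 1), v i (α (i.removeNth v)) ∈ I := fun i =>
    hv i _ (hα _ fun k => hv _)
  cases n with
  | zero => exact h1 0
  | succ n =>
    refine I.add_mem (Ideal.sum_mem _ fun i _ => zsmul_mem (h1 i) _)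
      (Ideal.sum_mem _ fun i _ => Ideal.sum_mem _ fun j _ => zsmul_mem (hα _ fun k => ?_) _)
    exact Fin.cases (lie_mem_derW (hv _) (hv _)) (fun k => hv _) k

theorem lieDer_mem_formN {n : ℕ} {α : Form K R n} (hα : α ∈ formN I n) {X : Der K R}
    (hX : X ∈ derW I) : lieDer X α ∈ formN I n := by
  cases n with
  | zero => exact ins_mem_formN (ceDiff_mem_formN hα) hX
  | succ n =>
    rw [lieDer_succ]
    exact add_mem (ins_mem_formN (ceDiff_mem_formN hα) hX) (ceDiff_mem_formN (ins_mem_formN hα hX))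

theorem contr_add_left (X Y : Der K R) {n : ℕ} (α : Form K R n) :
    contr (X + Y) α = contr X α + contr Y α := by
  cases n with
  | zero => exact (add_zero _).symm
  | succ n => exact ins_add_left X Y α

theorem contr_smul_left (c : R) (X : Der K R) {n : ℕ} (α : Form K R n) :
    contr (c • X) α = c • contr X α := by
  cases n with
  | zero => exact (smul_zero _).symm
  | succ n => exact ins_smul_left c X α

/-- Contraction with `f • X` is a multiple of `f`, so the constraint defining `B_W` is automatic
once `𝔛(A)_0 = I · 𝔛`. -/
theorem formW_eq_top (hI : derN (K := K) I ≤ I • ⊤) (n : ℕ) : formW (K := K) I n = ⊤ := by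
  refine eq_top_iff.2 fun α _ w hw => ?_
  refine Submodule.smul_induction_on (hI hw) (fun f hf X _ => ?_) fun X Y hX hY => ?_
  · rw [contr_smul_left]
    exact fun v _ => I.mul_mem_right _ hf
  · rw [contr_add_left]
    exact add_mem hX hY

/-- `L_{f X} α` agrees with `f L_X α` modulo terms `v(f) ι_X α`. -/
theorem lieDer_smul_left_apply (f : R) (X : Der K R) {n : ℕ} (α : Form K R (n + 1))
    (v : Fin (n + 1) → Der K R) :
    lieDer (f • X) α v = f * lieDer X α v +
      ∑ j : Fin (n + 1), (-1 : ℤ) ^ (j : ℕ) • (v j f * ins X α (j.removeNth v)) := by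
  have h3 : ∀ (y : Der K R) (z : Fin n → Der K R), 
          α (Matrix.vecCons (f • ⁅X, y⁆ - y f • X) z) =
          f * α (Matrix.vecCons ⁅X, y⁆ z) - y f * α (Matrix.vecCons X z) := by
    intro y z
    have h := congrArg (fun g : Form K R n => g z) (ins_sub_left (f • ⁅X, y⁆) (y f • X) α)
    simp only [ins_smul_left] at h
    exact h
  rw [lieDer_succ_apply, lieDer_succ_apply]
  simp only [smul_lie_der, h3, smul_sub, Finset.sum_sub_distrib, Derivation.smul_apply, smul_eq_mul,
    mul_sub, Finset.mul_sum, ins_apply, mul_smul_comm]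
  ring

theorem lieDer_smul_left_zero (f : R) (X : Der K R) (α : Form K R 0) :
    lieDer (f • X) α = f • lieDer X α := rfl

theorem lieDer_add_left (X Y : Der K R) {n : ℕ} (α : Form K R n) :
    lieDer (X + Y) α = lieDer X α + lieDer Y α := by
  cases n with
  | zero => exact ins_add_left _ _ _
  | succ n =>
    rw [lieDer_succ, lieDer_succ, lieDer_succ, ins_add_left, ins_add_left, map_add]
    abel

/-- The correction terms `v_j(f) ι_X α` lie in `I` because `ι_X α` is already in `B_0`. -/
theorem basic_smul_of_basic (f : R) {X : Der K R} {n : ℕ} {α : Form K R n}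
    (hα : contr X α ∈ formN I (n - 1)) (hα' : lieDer X α ∈ formN I n) :
    contr (f • X) α ∈ formN I (n - 1) ∧ lieDer (f • X) α ∈ formN I n := by
  refine ⟨by rw [contr_smul_left]; exact Submodule.smul_mem _ f hα, ?_⟩
  cases n with
  | zero => rw [lieDer_smul_left_zero]; exact Submodule.smul_mem _ f hα'
  | succ n =>
    intro v hv
    rw [lieDer_smul_left_apply]
    exact I.add_mem (I.mul_mem_left f (hα' v hv)) (Ideal.sum_mem _ fun j _ =>
      zsmul_mem (I.mul_mem_left _ (hα _ fun k => hv _)) _)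

/-- Here the correction terms lie in `I` because `v_j` preserves `I`, so nothing is required of `α`
or `X`. -/
theorem basic_smul_of_mem {f : R} (hf : f ∈ I) (X : Der K R) {n : ℕ} (α : Form K R n) :
    contr (f • X) α ∈ formN I (n - 1) ∧ lieDer (f • X) α ∈ formN I n := by
  refine ⟨by rw [contr_smul_left]; exact fun v _ => I.mul_mem_right _ hf, ?_⟩
  cases n with
  | zero => rw [lieDer_smul_left_zero]; exact fun v _ => I.mul_mem_right _ hf
  | succ n =>
    intro v hv
    rw [lieDer_smul_left_apply]
    exact I.add_mem (I.mul_mem_right _ hf) (Ideal.sum_mem _ fun j _ =>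
      zsmul_mem (I.mul_mem_right _ (hv j f hf)) _)

theorem basic_spanLR {F : Set (Der K R)} {n : ℕ} {α : Form K R n}
    (hα : ∀ ξ : Der K R, ξ ∈ F → contr ξ α ∈ formN I (n - 1) ∧ lieDer ξ α ∈ formN I n)
    {ξ : Der K R} (hξ : ξ ∈ spanLR I F) :
    contr ξ α ∈ formN I (n - 1) ∧ lieDer ξ α ∈ formN I n := by
  refine spanLR_induction (P := fun ξ : Der K R => contr ξ α ∈ formN I (n - 1) ∧ lieDer ξ α ∈ formN I n)
    ?_ ?_ ?_ hξ
  · exact fun f ξ hξ => basic_smul_of_basic f (hα ξ hξ).1 (hα ξ hξ).2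
  · exact fun f hf X => basic_smul_of_mem hf X α
  · intro X Y hX hY
    rw [contr_add_left, lieDer_add_left]
    exact ⟨add_mem hX.1 hY.1, add_mem hX.2 hY.2⟩

end Constraint

end

end ConstraintReduction

namespace ConstraintReduction

noncomputable section

section Reduction

variable {K : Type*} [Field K] [CharZero K] {R : Type*} [CommRing R] [Algebra K R] {p : ℕ}
  {I : Ideal R}

/-! ### Reduction of the observables -/

theorem mem_basicW_symLR_iff {F : LieSubalgebra K (Der K R)} (hF : ∀ ξ ∈ F, ξ ∈ derW I)
    (hI : derN (K := K) I ≤ I • ⊤) {n : ℕ} {α : Form K R n} :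
    α ∈ basicW I (symLR I (F : Set (Der K R))) n ↔
      ∀ ξ ∈ F, contr ξ α ∈ formN I (n - 1) ∧ lieDer ξ α ∈ formN I n := by
  constructor
  · intro h ξ hξ
    refine h.2 ξ ?_
    rw [symLR_eq_spanLR hF hI]
    exact Submodule.mem_sup_left (Submodule.subset_span hξ)
  · intro h
    refine ⟨by rw [formW_eq_top hI]; trivial, fun ξ hξ => ?_⟩
    rw [symLR_eq_spanLR hF hI] at hξ
    exact basic_spanLR h hξ

theorem mem_normW_symLR_iff {F : LieSubalgebra K (Der K R)} (hF : ∀ ξ ∈ F, ξ ∈ derW I)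
    (hI : derN (K := K) I ≤ I • ⊤) {X : Der K R} :
    X ∈ normW I (symLR I (F : Set (Der K R))) ↔
      X ∈ derW I ∧ ∀ ξ ∈ F, ⁅ξ, X⁆ ∈ spanLR I (F : Set (Der K R)) := by
  constructor
  · rintro ⟨hX, h⟩
    rw [symLR_eq_spanLR hF hI] at h
    exact ⟨hX, fun ξ hξ => h ξ (Submodule.mem_sup_left (Submodule.subset_span hξ))⟩
  · rintro ⟨hX, h⟩
    refine ⟨hX, fun ξ hξ => ?_⟩
    rw [symLR_eq_spanLR hF hI] at hξ ⊢
    exact lie_mem_spanLR hX h hξ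

variable {L : Submodule R (Der K R)}

theorem formN_le_basicW (hL : L ≤ derW I) {n : ℕ} {α : Form K R n} (hα : α ∈ formN I n) :
    α ∈ basicW I L n :=
  ⟨fun _ hw => contr_mem_formN hα (derN_le_derW hw),
    fun _ hξ => ⟨contr_mem_formN hα (hL hξ), lieDer_mem_formN hα (hL hξ)⟩⟩

/-- `L_ξ ι_X = ι_X L_ξ + ι_{[ξ, X]}`, and the normalizer condition puts `[ξ, X]` back into `L`. -/
theorem ins_mem_basicW (hI : derN (K := K) I ≤ I • ⊤) {n : ℕ} {α : Form K R (n + 1)}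
    (hα : α ∈ basicW I L (n + 1)) {X : Der K R} (hX : X ∈ normW I L) :
    ins X α ∈ basicW I L n := by
  refine ⟨by rw [formW_eq_top hI]; trivial, fun ξ hξ => ⟨?_, ?_⟩⟩
  · cases n with
    | zero => exact zero_mem _
    | succ n =>
      rw [contr_succ, ins_ins_swap]
      exact neg_mem (ins_mem_formN (hα.2 ξ hξ).1 hX.1)
  · rw [lieDer_ins]
    exact add_mem (ins_mem_formN (hα.2 ξ hξ).2 hX.1) (hα.2 _ (hX.2 ξ hξ)).1

/-- `ι_ξ d α = L_ξ α - d ι_ξ α` and `L_ξ d = d L_ξ`, while `B_0` is stable under `d`. -/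
theorem ceDiff_mem_basicW (hI : derN (K := K) I ≤ I • ⊤) {n : ℕ} {α : Form K R n}
    (hα : α ∈ basicW I L n) : ceDiff α ∈ basicW I L (n + 1) := by
  refine ⟨by rw [formW_eq_top hI]; trivial, fun ξ hξ => ⟨?_, ?_⟩⟩
  · rw [contr_succ]
    cases n with
    | zero => exact (hα.2 ξ hξ).2
    | succ n =>
      rw [← add_sub_cancel_right (ins ξ (ceDiff α)) (ceDiff (ins ξ α)), ← lieDer_succ]
      exact sub_mem (hα.2 ξ hξ).2 (ceDiff_mem_formN (hα.2 ξ hξ).1)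
  · rw [lieDer_ceDiff]
    exact ceDiff_mem_formN (hα.2 ξ hξ).2

theorem multiIns_mem_basicW (hI : derN (K := K) I ≤ I • ⊤) {α : TotalForm K R}
    (hα : ∀ m, α m ∈ basicW I L m) : ∀ {n : ℕ} {X : Fin n → Der K R},
      (∀ i, X i ∈ normW I L) → ∀ m, multiIns α n X m ∈ basicW I L m
  | 0, X, _, m => by rw [multiIns_zero]; exact hα m
  | n + 1, X, hX, m => by
    rw [multiIns_succ, insT_apply]
    exact ins_mem_basicW hI (multiIns_mem_basicW hI hα (fun i => hX i.succ) (m + 1)) (hX 0)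

/-- The contractions to the right of `X i` leave a basic form, `X i ∈ L` sends it into `B_0`, and
the contractions to the left preserve `B_0`. -/
theorem multiIns_mem_formN (hI : derN (K := K) I ≤ I • ⊤) {α : TotalForm K R}
    (hα : ∀ m, α m ∈ basicW I L m) : ∀ {n : ℕ} {X : Fin n → Der K R},
      (∀ i, X i ∈ normW I L) → ∀ i, X i ∈ L → ∀ m, multiIns α n X m ∈ formN I m
  | 0, X, _, i, _, m => i.elim0
  | n + 1, X, hX, i, hi, m => by
    rw [multiIns_succ, insT_apply]
    revert hi
    refine Fin.cases (fun hi => ?_) (fun i hi => ?_) i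
    · exact ((multiIns_mem_basicW hI hα (fun i => hX i.succ) (m + 1)).2 _ hi).1
    · exact ins_mem_formN (multiIns_mem_formN hI hα (fun i => hX i.succ) i hi (m + 1)) (hX 0).1

theorem single_mem_basicW {N : ℕ} {ω : Form K R N} (hω : ω ∈ basicW I L N) (m : ℕ) :
    (Pi.single N ω : TotalForm K R) m ∈ basicW I L m := by
  rcases eq_or_ne m N with rfl | h
  · rwa [Pi.single_eq_same]
  · rw [Pi.single_eq_of_ne h]
    exact zero_mem _

theorem mem_hamW_iff {F : Set (Der K R)} {ω : Form K R (p + 2)} {x : Amb K R p} :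
    x ∈ hamW I F ω ↔ x ∈ ham ω ∧ (∀ m : Fin (p + 1), x.1 m ∈ basicW I (symLR I F) m) ∧
      x.2 ∈ normW I (symLR I F) := by
  simp [hamW, Submodule.mem_prod, Submodule.mem_pi]

theorem mem_hamN_iff {F : Set (Der K R)} {ω : Form K R (p + 2)} {x : Amb K R p} :
    x ∈ hamN I F ω ↔ x ∈ ham ω ∧ (∀ m : Fin (p + 1), x.1 m ∈ formN I m) ∧ x.2 ∈ symLR I F := by
  simp [hamN, Submodule.mem_prod, Submodule.mem_pi]

theorem obsBracket_mem_ham {ω : Form K R (p + 2)} (hω : ceDiff ω = 0) {n : ℕ}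
    {x : Fin n → Amb K R p} (hx : ∀ i, x i ∈ ham ω) : obsBracket ω n x ∈ ham ω := by
  rw [mem_ham_iff]
  match n, x, hx with
  | 0, x, hx => exact mem_ham_iff.1 (zero_mem (ham ω))
  | 1, x, hx =>
    rw [obsBracket_one_snd, ins_zero_left]
    cases p with
    | zero => exact (neg_eq_zero.2 (map_zero ceDiff)).symm
    | succ q => exact (neg_eq_zero.2 (ceDiff_ceDiff _)).symm
  | 2, x, hx =>
    -- `ι_{[X, Y]} ω = L_X ι_Y ω = d ι_X ι_Y ω`, since `L_X ω = 0` and `ι_Y ω` is closed.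
    have h0 := lieDer_of_mem_ham hω (hx 0)
    have h1 : ceDiff (ins (x 1).2 ω) = 0 := by
      rw [mem_ham_iff.1 (hx 1), map_neg, ceDiff_ceDiff, neg_zero]
    have h2 := lieDer_ins (x 0).2 (x 1).2 ω
    rw [h0, map_zero, zero_add, lieDer_succ, h1, map_zero, zero_add] at h2
    rw [obsBracket_two_snd, ← h2, obsBracket_fst ω 0, ← map_neg]
    have h3 : multiIns (Pi.single (p + 2) ω) 2 (fun i => (x i).2) p =
        ins (x 0).2 (ins (x 1).2 ω) := by
      rw [multiIns_succ, multiIns_succ, multiIns_zero, insT_apply, insT_apply, Pi.single_eq_same]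
      rfl
    refine congrArg ceDiff (h3.symm.trans ?_)
    norm_num
    rfl
  | j + 3, x, hx =>
    rw [obsBracket_snd_of_ne ω (by omega), ins_zero_left, obsBracket_fst ω (j + 1),
      multiIns_single_of_ne]
    · exact (neg_eq_zero.2 ((congrArg ceDiff (smul_zero _)).trans (map_zero ceDiff))).symm
    · rw [Fin.val_last]
      omega

theorem ambProj_mem_ham {ω : Form K R (p + 2)} (i : ℤ) {x : Amb K R p} (hx : x ∈ ham ω) :
    ambProj p i x ∈ ham ω := by
  rw [mem_ham_iff] at hx ⊢
  rw [ambProj_fst, ambProj_snd]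
  by_cases h : i = 0
  · rw [if_pos h, if_pos (by rw [Fin.val_last]; omega), hx]
  · rw [if_neg h, if_neg (by rw [Fin.val_last]; omega), ins_zero_left, map_zero, neg_zero]

theorem ambProj_mem_hamW {F : Set (Der K R)} {ω : Form K R (p + 2)} (i : ℤ) {x : Amb K R p}
    (hx : x ∈ hamW I F ω) : ambProj p i x ∈ hamW I F ω := by
  rw [mem_hamW_iff] at hx ⊢
  refine ⟨ambProj_mem_ham i hx.1, fun m => ?_, ?_⟩
  · rw [ambProj_fst]
    split_ifs
    · exact hx.2.1 m
    · exact zero_mem _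
  · rw [ambProj_snd]
    split_ifs
    · exact hx.2.2
    · exact zero_mem _

theorem ambProj_mem_hamN {F : Set (Der K R)} {ω : Form K R (p + 2)} (i : ℤ) {x : Amb K R p}
    (hx : x ∈ hamN I F ω) : ambProj p i x ∈ hamN I F ω := by
  rw [mem_hamN_iff] at hx ⊢
  refine ⟨ambProj_mem_ham i hx.1, fun m => ?_, ?_⟩
  · rw [ambProj_fst]
    split_ifs
    · exact hx.2.1 m
    · exact zero_mem _
  · rw [ambProj_snd]
    split_ifs
    · exact hx.2.2
    · exact zero_mem _

theorem lie_mem_normW {X Y : Der K R} (hX : X ∈ normW I L) (hY : Y ∈ normW I L) :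
    ⁅X, Y⁆ ∈ normW I L := by
  refine ⟨lie_mem_derW hX.1 hY.1, fun ξ hξ => ?_⟩
  rw [leibniz_lie, ← lie_skew X]
  exact add_mem (hY.2 _ (hX.2 ξ hξ)) (neg_mem (hX.2 _ (hY.2 ξ hξ)))

theorem obsBracket_mem_hamW {F : Set (Der K R)} (hI : derN (K := K) I ≤ I • ⊤)
    {ω : Form K R (p + 2)} (hω : ceDiff ω = 0) (hωW : ω ∈ basicW I (symLR I F) (p + 2)) {n : ℕ}
    {x : Fin n → Amb K R p} (hx : ∀ i, x i ∈ hamW I F ω) : obsBracket ω n x ∈ hamW I F ω := by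
  simp only [mem_hamW_iff] at hx ⊢
  refine ⟨obsBracket_mem_ham hω fun i => (hx i).1, ?_⟩
  match n, x, hx with
  | 0, x, hx => exact ⟨fun m => zero_mem _, zero_mem _⟩
  | 1, x, hx =>
    refine ⟨fun m => Fin.cases (zero_mem _) (fun m => ?_) m, zero_mem _⟩
    exact ceDiff_mem_basicW hI ((hx 0).2.1 m.castSucc)
  | j + 2, x, hx =>
    refine ⟨fun m => ?_, ?_⟩
    · rw [obsBracket_fst]
      exact zsmul_mem (multiIns_mem_basicW hI (single_mem_basicW hωW) (fun i => (hx i).2.2) m) _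
    · rw [obsBracket_snd]
      split_ifs
      · exact lie_mem_normW (hx 0).2.2 (hx 1).2.2
      · exact zero_mem _

theorem obsBracket_mem_hamN {F : Set (Der K R)} (hI : derN (K := K) I ≤ I • ⊤)
    {ω : Form K R (p + 2)} (hω : ceDiff ω = 0) (hωW : ω ∈ basicW I (symLR I F) (p + 2)) {n : ℕ}
    {x : Fin n → Amb K R p} (hx : ∀ i, x i ∈ hamW I F ω) {i : Fin n} (hi : x i ∈ hamN I F ω) :
    obsBracket ω n x ∈ hamN I F ω := by
  simp only [mem_hamW_iff] at hx
  rw [mem_hamN_iff] at hi ⊢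
  refine ⟨obsBracket_mem_ham hω fun i => (hx i).1, ?_⟩
  match n, x, hx, i, hi with
  | 0, x, hx, i, hi => exact i.elim0
  | 1, x, hx, i, hi =>
    obtain rfl : i = 0 := Subsingleton.elim _ _
    refine ⟨fun m => Fin.cases (zero_mem _) (fun m => ?_) m, zero_mem _⟩
    exact ceDiff_mem_formN (hi.2.1 m.castSucc)
  | j + 2, x, hx, i, hi =>
    refine ⟨fun m => ?_, ?_⟩
    · rw [obsBracket_fst]
      exact zsmul_mem (multiIns_mem_formN hI (single_mem_basicW hωW) (fun i => (hx i).2.2)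
        i hi.2.2 m) _
    · rw [obsBracket_snd]
      split_ifs with h
      · subst h
        fin_cases i
        · exact (hx 1).2.2.2 _ hi.2.2
        · rw [← lie_skew]
          exact neg_mem ((hx 0).2.2.2 _ hi.2.2)
      · exact zero_mem _

theorem hamN_le_hamW {F : LieSubalgebra K (Der K R)} (hF : ∀ ξ ∈ F, ξ ∈ derW I)
    (hI : derN (K := K) I ≤ I • ⊤) (ω : Form K R (p + 2)) :
    hamN I (F : Set (Der K R)) ω ≤ hamW I (F : Set (Der K R)) ω := by
  intro x hx
  rw [mem_hamN_iff, symLR_eq_spanLR hF hI] at hx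
  rw [mem_hamW_iff, symLR_eq_spanLR hF hI]
  refine ⟨hx.1, fun m => formN_le_basicW (spanLR_le_derW hF) (hx.2.1 m),
    spanLR_le_derW hF hx.2.2, fun ξ hξ => lie_mem_spanLR_of_mem hF hξ hx.2.2⟩

/-- As `ω` is closed, `L_ξ ω = d ι_ξ ω`, so the hypothesis on contractions suffices. -/
theorem mem_basicW_of_closed {F : LieSubalgebra K (Der K R)} (hF : ∀ ξ ∈ F, ξ ∈ derW I)
    (hI : derN (K := K) I ≤ I • ⊤) {ω : Form K R (p + 2)} (hω : ceDiff ω = 0)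
    (hωF : ∀ ξ ∈ F, ins ξ ω ∈ formN I (p + 1)) :
    ω ∈ basicW I (symLR I (F : Set (Der K R))) (p + 2) := by
  rw [mem_basicW_symLR_iff hF hI]
  refine fun ξ hξ => ⟨hωF ξ hξ, ?_⟩
  rw [lieDer_succ, hω, map_zero, zero_add]
  exact ceDiff_mem_formN (hωF ξ hξ)

end Reduction

end

end ConstraintReduction

namespace ConstraintReduction

noncomputable section

section Hadamard

/-! ### Hadamard's lemma -/

open scoped ContDiff Topology

theorem hasFDerivAt_intervalIntegral_of_contDiff {H G : Type} [NormedAddCommGroup H]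
    [NormedSpace ℝ H] [FiniteDimensional ℝ H] [NormedAddCommGroup G] [NormedSpace ℝ G]
    [CompleteSpace G] {f : H × ℝ → G} (hf : ContDiff ℝ ∞ f) (x₀ : H) :
    HasFDerivAt (fun x => ∫ t in (0 : ℝ)..1, f (x, t))
      (∫ t in (0 : ℝ)..1, (fderiv ℝ f (x₀, t)).comp (ContinuousLinearMap.inl ℝ H ℝ)) x₀ := by
  have : ProperSpace H := FiniteDimensional.proper ℝ H
  have hc' : Continuous fun z : H × ℝ => (fderiv ℝ f z).comp (ContinuousLinearMap.inl ℝ H ℝ) :=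
    (hf.continuous_fderiv (by simp)).clm_comp continuous_const
  -- The dominating function is a constant, by compactness of the unit ball times `[0, 1]`.
  obtain ⟨C, hC⟩ := ((isCompact_closedBall x₀ 1).prod (isCompact_Icc (a := (0 : ℝ)) (b := 1)))
    |>.exists_bound_of_continuousOn hc'.continuousOn
  refine intervalIntegral.hasFDerivAt_integral_of_dominated_of_fderiv_le (𝕜 := ℝ)
    (F := fun x t => f (x, t)) (bound := fun _ => C)
    (F' := fun x t => (fderiv ℝ f (x, t)).comp (ContinuousLinearMap.inl ℝ H ℝ))
    (Metric.closedBall_mem_nhds x₀ one_pos) ?_ ?_ ?_ ?_ ?_ ?_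
  · exact Filter.Eventually.of_forall fun x =>
      (hf.continuous.comp (by fun_prop : Continuous fun t : ℝ => (x, t))).aestronglyMeasurable
  · exact (hf.continuous.comp (by fun_prop : Continuous fun t : ℝ => (x₀, t))).intervalIntegrable _ _
  · exact (hc'.comp (by fun_prop : Continuous fun t : ℝ => (x₀, t))).aestronglyMeasurable
  · refine Filter.Eventually.of_forall fun t ht x hx => hC (x, t) ⟨hx, ?_⟩
    rw [Set.uIoc_of_le zero_le_one] at ht
    exact Set.Ioc_subset_Icc_self ht
  · exact intervalIntegrable_const
  · refine Filter.Eventually.of_forall fun t _ x _ => ?_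
    exact (hf.differentiable (by simp) (x, t)).hasFDerivAt.comp x
      (hasFDerivAt_prodMk_left x t)

/-- The derivative is again an integral of the same kind with operator-valued integrand, hence the
induction is over all targets `G`. -/
theorem contDiff_intervalIntegral {H : Type} [NormedAddCommGroup H] [NormedSpace ℝ H]
    [FiniteDimensional ℝ H] (n : ℕ) : ∀ {G : Type} [NormedAddCommGroup G] [NormedSpace ℝ G]
    [CompleteSpace G] {f : H × ℝ → G}, ContDiff ℝ ∞ f →
    ContDiff ℝ n (fun x => ∫ t in (0 : ℝ)..1, f (x, t)) := by
  induction n with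
  | zero =>
    intro G _ _ _ f hf
    exact contDiff_zero.2 (continuous_iff_continuousAt.2 fun x =>
      (hasFDerivAt_intervalIntegral_of_contDiff hf x).continuousAt)
  | succ n ih =>
    intro G _ _ _ f hf
    refine (contDiff_succ_iff_hasFDerivAt (n := n)).2
      ⟨_, ih (f := fun z => (fderiv ℝ f z).comp (ContinuousLinearMap.inl ℝ H ℝ)) ?_,
        hasFDerivAt_intervalIntegral_of_contDiff hf⟩
    exact (hf.fderiv_right (m := ∞) (by simp)).clm_comp contDiff_const

/-- Integrate `d/dt F(y₀ + t(y - y₀))` over `[0, 1]`; `k a` is the integral of the `a`-th partial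
derivative along the segment. -/
theorem hadamard {n : ℕ} {F : EuclideanSpace ℝ (Fin n) → ℝ} (hF : ContDiff ℝ ∞ F)
    (y₀ : EuclideanSpace ℝ (Fin n)) :
    ∃ k : Fin n → EuclideanSpace ℝ (Fin n) → ℝ, (∀ a, ContDiff ℝ ∞ (k a)) ∧
      (∀ y, F y = F y₀ + ∑ a, (y a - y₀ a) * k a y) ∧
      ∀ a, k a y₀ = fderiv ℝ F y₀ (EuclideanSpace.single a 1) := by
  have hseg : ContDiff ℝ ∞ fun z : EuclideanSpace ℝ (Fin n) × ℝ =>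
      fderiv ℝ F (y₀ + z.2 • (z.1 - y₀)) :=
    (hF.fderiv_right (m := ∞) (by simp)).comp (by fun_prop)
  refine ⟨fun a y => ∫ t in (0 : ℝ)..1, fderiv ℝ F (y₀ + t • (y - y₀)) (EuclideanSpace.single a 1),
    fun a => contDiff_infty.2 fun m => contDiff_intervalIntegral m
      (f := fun z => fderiv ℝ F (y₀ + z.2 • (z.1 - y₀)) (EuclideanSpace.single a 1))
      (hseg.clm_apply contDiff_const), fun y => ?_, fun a => by simp⟩
  have hcont : ∀ v, Continuous fun t : ℝ => fderiv ℝ F (y₀ + t • (y - y₀)) v := fun v =>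
    ((hF.continuous_fderiv (by simp)).comp (by fun_prop)).clm_apply continuous_const
  have h1 : ∫ t in (0 : ℝ)..1, fderiv ℝ F (y₀ + t • (y - y₀)) (y - y₀) = F y - F y₀ := by
    rw [intervalIntegral.integral_eq_sub_of_hasDerivAt
      (f := fun t : ℝ => F (y₀ + t • (y - y₀))) _ ((hcont _).intervalIntegrable _ _)]
    · simp
    · intro t _
      refine (hF.differentiable (by simp) _).hasFDerivAt.comp_hasDerivAt t ?_
      simpa using ((hasDerivAt_id t).smul_const (y - y₀)).const_add y₀
  have h2 : ∀ L : EuclideanSpace ℝ (Fin n) →L[ℝ] ℝ,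
      L (y - y₀) = ∑ a, (y a - y₀ a) * L (EuclideanSpace.single a 1) := fun L => by
    conv_lhs => rw [← (EuclideanSpace.basisFun (Fin n) ℝ).sum_repr (y - y₀), map_sum]
    simp
  rw [← sub_eq_iff_eq_add', ← h1]
  simp_rw [h2]
  rw [intervalIntegral.integral_finsetSum fun a _ =>
    ((hcont _).const_mul _).intervalIntegrable _ _]
  simp_rw [intervalIntegral.integral_const_mul]

end Hadamard

end

end ConstraintReduction

namespace ConstraintReduction
noncomputable section
section LocalDerivations

/-! ### Derivations in a chart -/

open scoped ContDiff Topology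

variable {n : ℕ} {M : Type*} [TopologicalSpace M] [ChartedSpace (EuclideanSpace ℝ (Fin n)) M]
  [IsManifold (𝓡 n) (⊤ : ℕ∞) M] [T2Space M]

/-- A smooth bump function as an element of `C^∞(M)`. -/
def bumpFn {c : M} (b : SmoothBumpFunction (𝓡 n) c) : Smooth n M := ⟨b, b.contMDiff⟩

/-- The product of a bump function with the pullback of a function along the chart. -/
def pullCutoff {c : M} (b : SmoothBumpFunction (𝓡 n) c) (k : EuclideanSpace ℝ (Fin n) → ℝ)
    (hk : ContDiff ℝ ∞ k) : Smooth n M :=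
  ⟨fun x => b x • k (extChartAt (𝓡 n) c x),
    b.contMDiff_smul (hk.contMDiff.comp_contMDiffOn contMDiffOn_extChartAt)⟩

/-- The coordinate function of a chart, multiplied by a bump function. -/
def coordFn {c : M} (b : SmoothBumpFunction (𝓡 n) c) (a : Fin n) : Smooth n M :=
  pullCutoff b (fun y => y a) (by fun_prop)

theorem contDiffOn_comp_extChartAt_symm (c : M) (f : Smooth n M) :
    ContDiffOn ℝ ∞ (f ∘ (extChartAt (𝓡 n) c).symm) (extChartAt (𝓡 n) c).target :=
  (f.contMDiff.comp_contMDiffOn (contMDiffOn_extChartAt_symm c)).contDiffOn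

theorem contDiffAt_comp_extChartAt_symm {c x : M} (hx : x ∈ (extChartAt (𝓡 n) c).source)
    (f : Smooth n M) :
    ContDiffAt ℝ ∞ (f ∘ (extChartAt (𝓡 n) c).symm) (extChartAt (𝓡 n) c x) :=
  (contDiffOn_comp_extChartAt_symm c f).contDiffAt
    ((isOpen_extChartAt_target c).mem_nhds ((extChartAt (𝓡 n) c).map_source hx))

/-- A function multiplied by a bump function, read in the chart. -/
def pushCutoff {c : M} (b : SmoothBumpFunction (𝓡 n) c) (f : Smooth n M) :
    EuclideanSpace ℝ (Fin n) → ℝ :=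
  (extChartAt (𝓡 n) c).target.indicator ((bumpFn b * f : Smooth n M) ∘ (extChartAt (𝓡 n) c).symm)

theorem contDiff_pushCutoff {c : M} (b : SmoothBumpFunction (𝓡 n) c) (f : Smooth n M) :
    ContDiff ℝ ∞ (pushCutoff b f) := by
  refine contDiff_iff_contDiffAt.2 fun y => ?_
  by_cases hy : y ∈ (extChartAt (𝓡 n) c).target
  · have hn := (isOpen_extChartAt_target (I := 𝓡 n) c).mem_nhds hy
    refine ((contDiffOn_comp_extChartAt_symm c (bumpFn b * f)).contDiffAt hn).congr_of_eventuallyEq ?_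
    filter_upwards [hn] with z hz
    exact Set.indicator_of_mem hz _
  -- The chart image of the bump's support is compact, hence closed, and the function vanishes off
  -- it; this gives smoothness across the boundary of the chart target.
  · have hK : IsClosed (extChartAt (𝓡 n) c '' tsupport b) :=
      (b.hasCompactSupport.isCompact.image_of_continuousOn ((continuousOn_extChartAt c).mono
        b.tsupport_subset_extChartAt_source)).isClosed
    have hyK : y ∉ extChartAt (𝓡 n) c '' tsupport b := by
      rintro ⟨x, hx, rfl⟩
      exact hy ((extChartAt (𝓡 n) c).map_source (b.tsupport_subset_extChartAt_source hx))
    refine (contDiffAt_const (c := (0 : ℝ))).congr_of_eventuallyEq ?_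
    filter_upwards [hK.isOpen_compl.mem_nhds hyK] with z hz
    refine Set.indicator_apply_eq_zero.2 fun hzt => ?_
    by_contra h
    refine hz ⟨(extChartAt (𝓡 n) c).symm z, subset_tsupport _ fun h0 => h ?_,
      (extChartAt (𝓡 n) c).right_inv hzt⟩
    change b _ * f _ = 0
    rw [h0, zero_mul]

variable {c : M} (b : SmoothBumpFunction (𝓡 n) c)

theorem mem_source_of_eventuallyEq_one {x : M} (hx : b =ᶠ[𝓝 x] 1) :
    x ∈ (extChartAt (𝓡 n) c).source :=
  b.tsupport_subset_extChartAt_source (subset_tsupport _ (by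
    rw [Function.mem_support, hx.eq_of_nhds]; exact one_ne_zero))

theorem pushCutoff_eventuallyEq {x : M} (hx : b =ᶠ[𝓝 x] 1) (f : Smooth n M) :
    pushCutoff b f =ᶠ[𝓝 (extChartAt (𝓡 n) c x)] f ∘ (extChartAt (𝓡 n) c).symm := by
  have hs := mem_source_of_eventuallyEq_one b hx
  have ht := (isOpen_extChartAt_target (I := 𝓡 n) c).mem_nhds ((extChartAt (𝓡 n) c).map_source hs)
  have hc : Filter.Tendsto (extChartAt (𝓡 n) c).symm (𝓝 (extChartAt (𝓡 n) c x)) (𝓝 x) := by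
    have := continuousAt_extChartAt_symm' (I := 𝓡 n) hs
    rwa [ContinuousAt, (extChartAt (𝓡 n) c).left_inv hs] at this
  filter_upwards [ht, hc.eventually hx] with z hz h1
  rw [pushCutoff, Set.indicator_of_mem hz]
  change b _ * f _ = f _
  rw [h1]
  exact one_mul _

/-- The partial derivative along a coordinate of a chart, multiplied by a bump function. -/
def partialDer (a : Fin n) : Der ℝ (Smooth n M) :=
  Derivation.mk'
    { toFun := fun f => ⟨fun x => b x •
          fderiv ℝ (f ∘ (extChartAt (𝓡 n) c).symm) (extChartAt (𝓡 n) c x)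
            (EuclideanSpace.single a 1), b.contMDiff_smul <| by
          have h := ((contDiffOn_comp_extChartAt_symm c f).fderiv_of_isOpen (m := ∞)
            (isOpen_extChartAt_target c) (by simp)).clm_apply
            (contDiffOn_const (c := EuclideanSpace.single a (1 : ℝ)))
          refine (h.contMDiffOn.comp (contMDiffOn_extChartAt (x := c)) fun x hx => ?_)
          exact (extChartAt (𝓡 n) c).map_source (by simpa using hx)⟩
      map_add' := fun f g => by
        ext x
        by_cases hx : x ∈ (extChartAt (𝓡 n) c).source
        · have hf := (contDiffAt_comp_extChartAt_symm hx f).differentiableAt (by simp)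
          have hg := (contDiffAt_comp_extChartAt_symm hx g).differentiableAt (by simp)
          have := fderiv_add hf hg
          change b x * fderiv ℝ (f ∘ (extChartAt (𝓡 n) c).symm + g ∘ (extChartAt (𝓡 n) c).symm) _ _
            = b x * _ + b x * _
          rw [this, ← mul_add]
          rfl
        -- Outside the chart domain `fderiv` has no meaning, but the bump factor vanishes.
        · have h0 : b x = 0 := by
            by_contra h
            exact hx (b.tsupport_subset_extChartAt_source (subset_tsupport _ h))
          change b x * _ = b x * _ + b x * _
          simp [h0]
      map_smul' := fun r f => by
        ext x
        change b x * fderiv ℝ (r • (f ∘ (extChartAt (𝓡 n) c).symm)) _ _ = r * (b x * _)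
        rw [fderiv_const_smul_field, mul_left_comm]
        rfl }
    fun f g => by
      ext x
      change b x * fderiv ℝ ((f ∘ (extChartAt (𝓡 n) c).symm) * (g ∘ (extChartAt (𝓡 n) c).symm)) _ _
        = f x * (b x * _) + g x * (b x * _)
      by_cases hx : x ∈ (extChartAt (𝓡 n) c).source
      · have hf := (contDiffAt_comp_extChartAt_symm hx f).differentiableAt (by simp)
        have hg := (contDiffAt_comp_extChartAt_symm hx g).differentiableAt (by simp)
        rw [fderiv_mul hf hg]
        have hl : ∀ h : Smooth n M,
            (h ∘ (extChartAt (𝓡 n) c).symm) (extChartAt (𝓡 n) c x) = h x := fun h => by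
          rw [Function.comp_apply, (extChartAt (𝓡 n) c).left_inv hx]
        rw [add_apply, smul_apply,
          smul_apply, hl, hl, smul_eq_mul, smul_eq_mul]
        ring
      · have h0 : b x = 0 := by
          by_contra h
          exact hx (b.tsupport_subset_extChartAt_source (subset_tsupport _ h))
        simp [h0]

theorem partialDer_apply {x : M} (hx : b =ᶠ[𝓝 x] 1) (a : Fin n) (f : Smooth n M) :
    partialDer b a f x =
      fderiv ℝ (pushCutoff b f) (extChartAt (𝓡 n) c x) (EuclideanSpace.single a 1) := by
  rw [(pushCutoff_eventuallyEq b hx f).fderiv_eq]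
  change b x * _ = _
  rw [hx.eq_of_nhds]
  exact one_mul _

/-- With a bump `b` at `x` supported where `f = g`, the product `b (f - g)` is zero; the Leibniz
rule at `x` leaves `X(f - g)(x) = 0`. -/
theorem derivation_congr_of_eventuallyEq (X : Der ℝ (Smooth n M)) {f g : Smooth n M} {x : M}
    (h : f =ᶠ[𝓝 x] g) : X f x = X g x := by
  obtain ⟨b, hb⟩ := (SmoothBumpFunction.nhds_basis_support (I := 𝓡 n) h).ex_mem
  have h0 : bumpFn b * (f - g) = 0 := by
    ext z
    change b z * (f z - g z) = 0
    by_cases hz : b z = 0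
    · rw [hz, zero_mul]
    · have : f z = g z := hb (subset_tsupport _ hz)
      rw [this, sub_self, mul_zero]
  have h1 := congrArg (fun u : Smooth n M => u x) ((X.leibniz _ _).symm.trans (congrArg X h0))
  have h2 : f x - g x = 0 := sub_eq_zero.2 h.eq_of_nhds
  have h3 : b x * X (f - g) x + (f x - g x) * X (bumpFn b) x = (X 0 : Smooth n M) x := h1
  rw [b.eq_one, h2, zero_mul, one_mul, add_zero, map_zero, map_sub] at h3
  exact sub_eq_zero.1 h3

/-- Hadamard writes `f` near `x` as a constant plus `∑ (y_a - y_a(x)) k_a`; applying `X` at `x`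
kills all terms but `X(y_a) k_a(x)`, and `k_a(x)` is the partial derivative. -/
theorem derivation_apply_eq_sum (X : Der ℝ (Smooth n M)) (f : Smooth n M) {x : M}
    (hx : b =ᶠ[𝓝 x] 1) : X f x = ∑ a, X (coordFn b a) x * partialDer b a f x := by
  obtain ⟨k, hk, hF, hk₀⟩ := hadamard (contDiff_pushCutoff b f) (extChartAt (𝓡 n) c x)
  have hval : ∀ z, b =ᶠ[𝓝 z] 1 → pushCutoff b f (extChartAt (𝓡 n) c z) = f z := fun z hz => by
    rw [(pushCutoff_eventuallyEq b hz f).eq_of_nhds, Function.comp_apply,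
      (extChartAt (𝓡 n) c).left_inv (mem_source_of_eventuallyEq_one b hz)]
  have hcoord : ∀ a, coordFn b a x = extChartAt (𝓡 n) c x a := fun a => by
    change b x * _ = _
    rw [hx.eq_of_nhds]
    exact one_mul _
  have hpull : ∀ a, pullCutoff b (k a) (hk a) x = partialDer b a f x := fun a => by
    rw [partialDer_apply b hx, ← hk₀]
    change b x * _ = _
    rw [hx.eq_of_nhds]
    exact one_mul _
  have hfg : f =ᶠ[𝓝 x] (algebraMap ℝ (Smooth n M) (pushCutoff b f (extChartAt (𝓡 n) c x)) +
      ∑ a, (coordFn b a - algebraMap ℝ (Smooth n M) (extChartAt (𝓡 n) c x a)) *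
        pullCutoff b (k a) (hk a) : Smooth n M) := by
    filter_upwards [hx.eventuallyEq_nhds] with z hz
    rw [← hval z hz, hF]
    have hs : ∀ u : Fin n → Smooth n M, (∑ a, u a) z = ∑ a, u a z := fun u =>
      map_sum (ContMDiffMap.evalRingHom z : Smooth n M →+* ℝ) u _
    change _ = _ + (∑ a, _ : Smooth n M) z
    rw [hs]
    refine congrArg₂ _ rfl (Finset.sum_congr rfl fun a _ => ?_)
    change _ = (b z * _ - _) * (b z * _)
    rw [hz.eq_of_nhds]
    simp only [Pi.one_apply, one_mul]
    rfl
  rw [derivation_congr_of_eventuallyEq X hfg, map_add, Derivation.map_algebraMap, zero_add, map_sum]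
  have hs : ∀ u : Fin n → Smooth n M, (∑ a, u a) x = ∑ a, u a x := fun u =>
    map_sum (ContMDiffMap.evalRingHom x : Smooth n M →+* ℝ) u _
  rw [hs]
  refine Finset.sum_congr rfl fun a _ => ?_
  rw [X.leibniz, map_sub, Derivation.map_algebraMap, sub_zero]
  change (coordFn b a x - extChartAt (𝓡 n) c x a) * _ + pullCutoff b (k a) (hk a) x * _ = _
  rw [hcoord, sub_self, zero_mul, zero_add, hpull, mul_comm]

end LocalDerivations
end
end ConstraintReduction

namespace ConstraintReduction
noncomputable section
section GenericVectors

/-! ### Generic linear combinations of countably many families of covectors -/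

variable {E ι : Type*} [NormedAddCommGroup E] [NormedSpace ℝ E] [FiniteDimensional ℝ E]
  [Countable ι] {N : ℕ}

/-- The bad `w` form a countable union of `C^1` images of `E × E`, of Hausdorff dimension at most `2
dim E < N`. -/
theorem exists_add_sum_smul_ne_zero (hN : 2 * Module.finrank ℝ E < N)
    (D : ι → ℕ → E → (E →L[ℝ] ℝ)) (hD : ∀ i j, ContDiff ℝ 1 (D i j)) (k : ℕ)
    (p : ℕ → Fin N → ℝ) :
    ∃ w : Fin N → ℝ, ∀ i y v, ∑ j ∈ Finset.range k, D i j y v • p j + w ≠ 0 := by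
  have hdim : dimH (⋃ i, Set.range fun z : E × E => -∑ j ∈ Finset.range k, D i j z.1 z.2 • p j) <
      Module.finrank ℝ (Fin N → ℝ) := by
    rw [dimH_iUnion]
    refine (iSup_le fun i => ContDiff.dimH_range_le (ContDiff.neg (ContDiff.sum fun j _ =>
      ((((hD i j).comp contDiff_fst).clm_apply contDiff_snd).smul contDiff_const)))).trans_lt ?_
    rw [Module.finrank_prod, ← two_mul, Module.finrank_fin_fun]
    exact_mod_cast hN
  obtain ⟨w, hw⟩ := (dense_compl_of_dimH_lt_finrank hdim).nonempty
  refine ⟨w, fun i y v h => hw (Set.mem_iUnion.2 ⟨i, (y, v), ?_⟩)⟩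
  exact (eq_neg_of_add_eq_zero_right h).symm

theorem exists_generic_vectors (hN : 2 * Module.finrank ℝ E < N)
    (D : ι → ℕ → E → (E →L[ℝ] ℝ)) (hD : ∀ i j, ContDiff ℝ 1 (D i j)) :
    ∃ a : ℕ → Fin N → ℝ, ∀ i y v m, ∑ j ∈ Finset.range m, D i j y v • a j = 0 →
      ∀ j < m, D i j y v = 0 := by
  choose w hw using exists_add_sum_smul_ne_zero hN D hD
  -- Each `a k` is generic with respect to its predecessors; the value `0` at later indices never
  -- enters the sum over `range k`.
  let a : ℕ → Fin N → ℝ := Nat.lt_wfRel.wf.fix fun k rec =>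
    w k fun j => if h : j < k then rec j h else 0
  have ha : ∀ k, a k = w k fun j => if j < k then a j else 0 := fun k =>
    Nat.lt_wfRel.wf.fix_eq _ k
  have hne : ∀ k i y v, ∑ j ∈ Finset.range k, D i j y v • a j + a k ≠ 0 := fun k i y v => by
    have := hw k (fun j => if j < k then a j else 0) i y v
    rw [← ha, Finset.sum_congr rfl fun j hj => by rw [if_pos (Finset.mem_range.1 hj)]] at this
    exact this
  refine ⟨a, fun i y v m => ?_⟩
  induction m with
  | zero => exact fun _ j hj => absurd hj j.not_lt_zero
  | succ m ih =>
    intro h j hj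
    rw [Finset.sum_range_succ] at h
    have h0 : D i m y v = 0 := by
      by_contra h0
      -- Rescaling `v` makes the last coefficient `1`, which the choice of `a m` excludes.
      refine hne m i y ((D i m y v)⁻¹ • v) ?_
      have := congrArg (fun u => (D i m y v)⁻¹ • u) h
      simp only [smul_add, Finset.smul_sum, smul_smul, inv_mul_cancel₀ h0, one_smul, smul_zero]
        at this
      simpa using this
    rcases Nat.lt_succ_iff_lt_or_eq.1 hj with hj | rfl
    · exact ih (by simpa [h0] using h) j hj
    · exact h0

end GenericVectors
end
end ConstraintReduction

namespace ConstraintReduction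
noncomputable section
section SeparatingFunctions

/-! ### Finitely many functions whose differentials span every cotangent space -/

open scoped ContDiff Topology

universe u

variable {n : ℕ} {M : Type u} [TopologicalSpace M] [ChartedSpace (EuclideanSpace ℝ (Fin n)) M]

theorem smooth_sum_apply {J : Type*} (s : Finset J) (u : J → Smooth n M) (x : M) :
    (∑ j ∈ s, u j) x = ∑ j ∈ s, u j x :=
  map_sum (ContMDiffMap.evalRingHom x : Smooth n M →+* ℝ) u s

theorem derivation_sum_apply {J : Type*} (s : Finset J) (X : J → Der ℝ (Smooth n M))
    (f : Smooth n M) : (∑ j ∈ s, X j) f = ∑ j ∈ s, X j f := by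
  rw [← Derivation.coeFnAddMonoidHom_apply, map_sum, Finset.sum_apply]
  rfl

/-- The sum of a locally finite family of smooth functions. -/
def locallyFiniteSum {J : Type*} (g : J → Smooth n M)
    (hg : LocallyFinite fun j => Function.support (g j)) : Smooth n M :=
  ⟨fun x => ∑ᶠ j, g j x, contMDiff_finsum (fun j => (g j).contMDiff) hg⟩

theorem locallyFiniteSum_eventuallyEq {J : Type*} (g : J → Smooth n M)
    (hg : LocallyFinite fun j => Function.support (g j)) {x : M} {s : Finset J} {U : Set M}
    (hU : U ∈ 𝓝 x) (hs : ∀ j, (Function.support (g j) ∩ U).Nonempty → j ∈ s) :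
    locallyFiniteSum g hg =ᶠ[𝓝 x] (∑ j ∈ s, g j : Smooth n M) := by
  filter_upwards [hU] with z hz
  rw [smooth_sum_apply]
  exact finsum_eq_sum_of_support_subset _ fun j hj => hs j ⟨z, hj, hz⟩

variable [IsManifold (𝓡 n) (⊤ : ℕ∞) M] [T2Space M]

theorem partialDer_coordFn {c : M} (b : SmoothBumpFunction (𝓡 n) c) {x : M}
    (hx : b =ᶠ[𝓝 x] 1) (a a' : Fin n) :
    partialDer b a' (coordFn b a) x = if a = a' then 1 else 0 := by
  have hs := mem_source_of_eventuallyEq_one b hx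
  have ht := (isOpen_extChartAt_target (I := 𝓡 n) c).mem_nhds ((extChartAt (𝓡 n) c).map_source hs)
  have hc : Filter.Tendsto (extChartAt (𝓡 n) c).symm (𝓝 (extChartAt (𝓡 n) c x)) (𝓝 x) := by
    have := continuousAt_extChartAt_symm' (I := 𝓡 n) hs
    rwa [ContinuousAt, (extChartAt (𝓡 n) c).left_inv hs] at this
  have h : pushCutoff b (coordFn b a) =ᶠ[𝓝 (extChartAt (𝓡 n) c x)]
      (EuclideanSpace.proj a : EuclideanSpace ℝ (Fin n) →L[ℝ] ℝ) := by
    filter_upwards [pushCutoff_eventuallyEq b hx (coordFn b a), ht, hc.eventually hx]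
      with z h1 hz h2
    rw [h1]
    change b _ * (extChartAt (𝓡 n) c ((extChartAt (𝓡 n) c).symm z)) a = z a
    rw [h2, (extChartAt (𝓡 n) c).right_inv hz]
    exact one_mul _
  rw [partialDer_apply b hx, h.fderiv_eq, ContinuousLinearMap.fderiv]
  simp

theorem sum_mul_partialDer_apply {c : M} (b : SmoothBumpFunction (𝓡 n) c) {x : M}
    (hx : b =ᶠ[𝓝 x] 1) (v : Fin n → ℝ) (f : Smooth n M) :
    (∑ a, v a • partialDer b a : Der ℝ (Smooth n M)) f x =
      fderiv ℝ (pushCutoff b f) (extChartAt (𝓡 n) c x) (WithLp.toLp 2 v) := by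
  have hv : WithLp.toLp 2 v = ∑ a, v a • EuclideanSpace.single a (1 : ℝ) := by
    conv_lhs => rw [← (EuclideanSpace.basisFun (Fin n) ℝ).sum_repr (WithLp.toLp 2 v)]
    simp
  rw [hv, map_sum, derivation_sum_apply, smooth_sum_apply]
  refine Finset.sum_congr rfl fun a _ => ?_
  rw [map_smul, ← partialDer_apply b hx]
  rfl

/-- The `H l` are generic combinations of all cut-off chart coordinates. Near a point only finitely
many of these are nonzero, so a vector killed by all `H l` is killed by each coordinate separately.
-/
theorem exists_separating_functions [SecondCountableTopology M] :
    ∃ (ι : Type u) (fs : SmoothBumpCovering ι (𝓡 n) M) (N : ℕ) (H : Fin N → Smooth n M),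
      ∀ i x, fs i =ᶠ[𝓝 x] 1 → ∀ v : Fin n → ℝ,
        (∀ l, (∑ a, v a • partialDer (fs i) a : Der ℝ (Smooth n M)) (H l) x = 0) → v = 0 := by
  have := ChartedSpace.locallyCompactSpace (EuclideanSpace ℝ (Fin n)) M
  obtain ⟨ι, fs, -⟩ := SmoothBumpCovering.exists_isSubordinate (𝓡 n) (M := M) isClosed_univ
    (U := fun _ => Set.univ) fun _ _ => Filter.univ_mem
  -- Second countability makes the locally finite covering countable, as the choice of generic
  -- vectors requires.
  have hι : Countable ι := Set.countable_univ_iff.1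
    (fs.locallyFinite.countable_univ fun i => (fs i).nonempty_support)
  obtain ⟨e, he⟩ := exists_injective_nat (ι × Fin n)
  let g : ℕ → Smooth n M := Function.extend e (fun q => coordFn (fs q.1) q.2) 0
  have hge : ∀ i a, g (e (i, a)) = coordFn (fs i) a := fun i a => he.extend_apply _ _ _
  have hgf : LocallyFinite fun j => Function.support (g j) := fun x => by
    obtain ⟨U, hU, hf⟩ := fs.locallyFinite x
    refine ⟨U, hU, ((hf.prod (Set.finite_univ (α := Fin n))).image e).subset ?_⟩
    rintro j ⟨z, hz, hzU⟩
    by_cases hj : ∃ q, e q = j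
    · obtain ⟨⟨i, a⟩, rfl⟩ := hj
      refine ⟨(i, a), ⟨⟨z, fun h0 => hz ?_, hzU⟩, Set.mem_univ _⟩, rfl⟩
      rw [hge]
      change fs i z * _ = 0
      rw [h0, zero_mul]
    · exact absurd (congrArg (fun u : Smooth n M => u z) (Function.extend_apply' _ _ _ hj)) hz
  obtain ⟨w, hw⟩ := exists_generic_vectors (E := EuclideanSpace ℝ (Fin n)) (N := 2 * n + 1)
    (by rw [finrank_euclideanSpace_fin]; exact Nat.lt_succ_self _) (fun i j => fderiv ℝ (pushCutoff (fs i) (g j)))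
    fun i j => ((contDiff_pushCutoff (fs i) (g j)).fderiv_right (m := ∞) (by simp)).of_le
      (by exact_mod_cast le_top)
  have hwf : ∀ l, LocallyFinite fun j => Function.support (w j l • g j : Smooth n M) := fun l =>
    hgf.subset fun j => Function.support_const_smul_subset _ _
  refine ⟨ι, fs, 2 * n + 1, fun l => locallyFiniteSum (fun j => w j l • g j) (hwf l),
    fun i x hx v hv => ?_⟩
  obtain ⟨U, hU, hf⟩ := hgf x
  -- `m` bounds the indices active near `x`, so that the sum is complete, and those of the
  -- coordinates of chart `i`, to which the conclusion is applied.
  obtain ⟨m, hm⟩ : ∃ m, ∀ j ∈ hf.toFinset ∪ Finset.univ.image fun a => e (i, a), j < m :=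
    ⟨_, fun j hj => Nat.lt_succ_of_le (Finset.le_sup (f := id) hj)⟩
  have h0 := hw i (extChartAt (𝓡 n) (fs.c i) x) (WithLp.toLp 2 v) m <| funext fun l => by
    have h1 := hv l
    rw [derivation_congr_of_eventuallyEq _ (locallyFiniteSum_eventuallyEq _ (hwf l)
      (s := Finset.range m) hU fun j hj => Finset.mem_range.2 (hm j (Finset.mem_union_left _
        (hf.mem_toFinset.2 (hj.mono (Set.inter_subset_inter_left _
          (Function.support_const_smul_subset _ _))))))), map_sum, smooth_sum_apply] at h1
    rw [Finset.sum_apply]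
    refine (Finset.sum_congr rfl fun j _ => ?_).trans h1
    rw [Pi.smul_apply, ← sum_mul_partialDer_apply (fs i) hx, Derivation.map_smul, smul_eq_mul, mul_comm]
    rfl
  funext a
  have h2 := h0 (e (i, a)) (hm _ (Finset.mem_union_right _ (Finset.mem_image_of_mem _
    (Finset.mem_univ a))))
  rw [← sum_mul_partialDer_apply (fs i) hx, hge, derivation_sum_apply,
    smooth_sum_apply] at h2
  rw [Pi.zero_apply, ← h2]
  refine (Eq.symm ?_)
  refine (Finset.sum_congr rfl fun a' _ => (?_ : _ = v a' * if a = a' then 1 else 0)).trans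
    (by simp)
  rw [← partialDer_coordFn (fs i) hx]
  rfl

end SeparatingFunctions
end
end ConstraintReduction

namespace ConstraintReduction
noncomputable section
section FiniteGeneration

/-! ### Vector fields form a finitely generated module -/

open scoped ContDiff Topology Matrix

universe u

variable {n : ℕ} {M : Type u} [TopologicalSpace M] [ChartedSpace (EuclideanSpace ℝ (Fin n)) M]

/-- `adj(JᵀJ) Jᵀ` is a division-free left inverse of `J` up to the factor `det(JᵀJ)`. -/
theorem sum_mulVec_mul_adjugate {A m n : Type*} [CommRing A] [Fintype m] [Fintype n]
    [DecidableEq n] (J : Matrix m n A) (u p : n → A) :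
    ∑ l, (J *ᵥ u) l * ∑ a, ((Jᵀ * J).adjugate * Jᵀ) a l * p a = (Jᵀ * J).det * (u ⬝ᵥ p) := by
  have h : ((Jᵀ * J).adjugate * Jᵀ) *ᵥ (J *ᵥ u) = (Jᵀ * J).det • u := by
    rw [Matrix.mulVec_mulVec, Matrix.mul_assoc, Matrix.adjugate_mul, Matrix.smul_mulVec,
      Matrix.one_mulVec]
  have key : ∀ (B : Matrix n m A) (w : m → A),
      ∑ l, w l * ∑ a, B a l * p a = (B *ᵥ w) ⬝ᵥ p := fun B w => by
    simp only [dotProduct, Matrix.mulVec, Finset.mul_sum, Finset.sum_mul]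
    rw [Finset.sum_comm]
    exact Finset.sum_congr rfl fun a _ => Finset.sum_congr rfl fun l _ => by ring
  rw [key, h, smul_dotProduct, smul_eq_mul]

/-- Over `ℝ`, `JᵀJ` and `J` have the same kernel. -/
theorem det_transpose_mul_self_ne_zero {m n : Type*} [Fintype m] [Fintype n] [DecidableEq n]
    (J : Matrix m n ℝ) (hJ : ∀ v, J *ᵥ v = 0 → v = 0) : (Jᵀ * J).det ≠ 0 := fun h => by
  obtain ⟨v, hv, h0⟩ := Matrix.exists_mulVec_eq_zero_iff.2 h
  have h1 : v ∈ LinearMap.ker (Jᵀ * J).mulVecLin := h0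
  rw [Matrix.ker_mulVecLin_transpose_mul_self] at h1
  exact hv (hJ v h1)

/-- The sum of derivations with coefficients in a locally finite family of functions. -/
def locallyFiniteSumDer {J : Type*} (r : J → Smooth n M)
    (hr : LocallyFinite fun j => Function.support (r j)) (Z : J → Der ℝ (Smooth n M)) :
    Der ℝ (Smooth n M) :=
  have hf : ∀ (u : J → ℝ) (x : M), (Function.support fun j => r j x * u j).Finite := fun u x =>
    (hr.point_finite x).subset fun j hj => left_ne_zero_of_mul hj
  Derivation.mk'
    { toFun := fun f => locallyFiniteSum (fun j => r j * Z j f)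
        (hr.subset fun j => Function.support_mul_subset_left _ _)
      map_add' := fun f g => by
        ext x
        change ∑ᶠ j, r j x * (Z j (f + g)) x =
          (∑ᶠ j, r j x * (Z j f) x) + ∑ᶠ j, r j x * (Z j g) x
        rw [← finsum_add_distrib (hf _ x) (hf _ x)]
        refine finsum_congr fun j => ?_
        rw [map_add, ← mul_add]
        rfl
      map_smul' := fun c f => by
        ext x
        change ∑ᶠ j, r j x * (Z j (c • f)) x = c * ∑ᶠ j, r j x * (Z j f) x
        rw [mul_finsum]
        refine finsum_congr fun j => ?_
        rw [Derivation.map_smul, mul_left_comm]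
        rfl }
    fun f g => by
      ext x
      change ∑ᶠ j, r j x * (Z j (f * g)) x =
        f x * (∑ᶠ j, r j x * (Z j g) x) + g x * ∑ᶠ j, r j x * (Z j f) x
      have hf' : ∀ h k : Smooth n M, (Function.support fun j => h x * (r j x * Z j k x)).Finite :=
        fun h k => (hf (fun j => Z j k x) x).subset fun j hj => right_ne_zero_of_mul hj
      rw [mul_finsum, mul_finsum, ← finsum_add_distrib (hf' f g) (hf' g f)]
      refine finsum_congr fun j => ?_
      rw [(Z j).leibniz]
      change r j x * (f x * Z j g x + g x * Z j f x) = _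
      ring

variable [IsManifold (𝓡 n) (⊤ : ℕ∞) M] [T2Space M]

/-- `J` is the Jacobian of `H` in the chart and `δ` its Gram determinant. The components of `X` are
recovered from the `X(H l)` by the left inverse of `J`, up to the factor `δ`. -/
theorem exists_local_generators {c : M} (b : SmoothBumpFunction (𝓡 n) c) {N : ℕ}
    (H : Fin N → Smooth n M)
    (hH : ∀ x, b =ᶠ[𝓝 x] 1 → ∀ v : Fin n → ℝ,
      (∀ l, (∑ a, v a • partialDer b a : Der ℝ (Smooth n M)) (H l) x = 0) → v = 0) :
    ∃ (δ : Smooth n M) (W : Fin N → Der ℝ (Smooth n M)), ∀ x, b =ᶠ[𝓝 x] 1 → δ x ≠ 0 ∧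
      ∀ (X : Der ℝ (Smooth n M)) (f : Smooth n M), δ x * X f x = ∑ l, X (H l) x * W l f x := by
  let J : Matrix (Fin N) (Fin n) (Smooth n M) := Matrix.of fun l a => partialDer b a (H l)
  refine ⟨(Jᵀ * J).det, fun l => ∑ a, ((Jᵀ * J).adjugate * Jᵀ) a l • partialDer b a,
    fun x hx => ?_⟩
  let ev : Smooth n M →+* ℝ := ContMDiffMap.evalRingHom x
  let Jx : Matrix (Fin N) (Fin n) ℝ := J.map ev
  have hG : (Jᵀ * J).map ev = Jxᵀ * Jx := Matrix.map_mul
  have hdet : (Jᵀ * J).det x = (Jxᵀ * Jx).det := (RingHom.map_det ev _).trans (by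
    rw [← hG]
    rfl)
  have hadj : ∀ a l, ((Jᵀ * J).adjugate * Jᵀ) a l x = ((Jxᵀ * Jx).adjugate * Jxᵀ) a l := by
    have h : (Jᵀ * J).adjugate.map ev = (Jxᵀ * Jx).adjugate :=
      (RingHom.map_adjugate ev _).trans (by
        rw [← hG]
        rfl)
    intro a l
    rw [← h]
    exact congrFun₂ (Matrix.map_mul (L := (Jᵀ * J).adjugate) (M := Jᵀ) (f := ev)) a l
  refine ⟨?_, fun X f => ?_⟩
  · rw [hdet]
    refine det_transpose_mul_self_ne_zero _ fun v hv => hH x hx v fun l => ?_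
    rw [derivation_sum_apply, smooth_sum_apply]
    exact (Finset.sum_congr rfl fun a _ => mul_comm _ _).trans (congrFun hv l)
  · have hXH : ∀ l, X (H l) x = (Jx *ᵥ fun a => X (coordFn b a) x) l := fun l => by
      rw [derivation_apply_eq_sum b X (H l) hx]
      exact Finset.sum_congr rfl fun a _ => mul_comm _ _
    rw [derivation_apply_eq_sum b X f hx, hdet]
    refine (sum_mulVec_mul_adjugate Jx (fun a => X (coordFn b a) x)
      fun a => partialDer b a f x).symm.trans (Finset.sum_congr rfl fun l _ => ?_)
    rw [hXH, derivation_sum_apply, smooth_sum_apply]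
    congr 1
    refine Finset.sum_congr rfl fun a _ => ?_
    rw [← hadj]
    rfl

/-- The local formulas use the same `H` in every chart, so after division by `δ i` they glue to
finitely many global fields. -/
theorem exists_generators [SecondCountableTopology M] :
    ∃ (N : ℕ) (H : Fin N → Smooth n M) (Y : Fin N → Der ℝ (Smooth n M)),
      ∀ X : Der ℝ (Smooth n M), X = ∑ l, X (H l) • Y l := by
  have := ChartedSpace.locallyCompactSpace (EuclideanSpace ℝ (Fin n)) M
  obtain ⟨ι, fs, N, H, hH⟩ := exists_separating_functions (n := n) (M := M)
  choose δ W hW using fun i => exists_local_generators (fs i) H (hH i)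
  obtain ⟨ρ, hρ⟩ := SmoothPartitionOfUnity.exists_isSubordinate (𝓡 n) (s := Set.univ)
    isClosed_univ (fun i => {x : M | fs i =ᶠ[𝓝 x] 1}) (fun i => isOpen_setOfPred_eventually_nhds)
    fun x _ => Set.mem_iUnion.2 ⟨_, fs.eventuallyEq_one x (Set.mem_univ x)⟩
  -- `ρ i / δ i` is smooth since `δ i` does not vanish on the closed support of `ρ i`.
  let ψ : ι → Smooth n M := fun i => ⟨fun x => ρ i x • (δ i x)⁻¹, ρ.contMDiff_smul fun x hx =>
    (δ i).contMDiff.contMDiffAt.inv₀ (hW i x (hρ i hx)).1⟩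
  have hψ : LocallyFinite fun i => Function.support (ψ i) :=
    ρ.locallyFinite.subset fun i => Function.support_smul_subset_left _ _
  refine ⟨N, H, fun l => locallyFiniteSumDer ψ hψ fun i => W i l, fun X => ?_⟩
  ext f x
  rw [derivation_sum_apply, smooth_sum_apply]
  change X f x = ∑ l, X (H l) x * ∑ᶠ i, ψ i x * W i l f x
  have hfin : ∀ u : ι → ℝ, (Function.support fun i => ψ i x * u i).Finite := fun u =>
    (hψ.point_finite x).subset fun j hj => left_ne_zero_of_mul hj
  calc X f x = (∑ᶠ i, ρ i x) * X f x := by rw [ρ.sum_eq_one (Set.mem_univ x), one_mul]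
    _ = ∑ᶠ i, ρ i x * X f x := finsum_mul _ _
    _ = ∑ᶠ i, ∑ l, X (H l) x * (ψ i x * W i l f x) := finsum_congr fun i => by
        by_cases hi : ρ i x = 0
        · have : ψ i x = 0 := by
            change ρ i x * _ = 0
            rw [hi, zero_mul]
          simp [this, hi]
        · obtain ⟨h0, h1⟩ := hW i x (hρ i (subset_tsupport _ hi))
          have : ψ i x * δ i x = ρ i x := inv_mul_cancel_right₀ h0 _
          rw [← this, mul_assoc, h1, Finset.mul_sum]
          exact Finset.sum_congr rfl fun l _ => mul_left_comm _ _ _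
    _ = ∑ l, ∑ᶠ i, X (H l) x * (ψ i x * W i l f x) :=
        finsum_sum_comm _ _ fun l _ => (hfin _).subset fun i hi => right_ne_zero_of_mul hi
    _ = _ := Finset.sum_congr rfl fun l _ => (mul_finsum _ _).symm

theorem derN_le_smul_top [SecondCountableTopology M] (I : Ideal (Smooth n M)) :
    derN (K := ℝ) I ≤ I • (⊤ : Submodule (Smooth n M) (Der ℝ (Smooth n M))) := fun X hX => by
  obtain ⟨N, H, Y, hY⟩ := exists_generators (n := n) (M := M)
  rw [hY X]
  exact Submodule.sum_mem _ fun l _ => Submodule.smul_mem_smul (hX (H l)) Submodule.mem_top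

end FiniteGeneration
end
end ConstraintReduction

/-! ### The reduction theorem -/

open ConstraintReduction in
theorem mainTheorem5 {n : ℕ} {M : Type*} [TopologicalSpace M]
    [ChartedSpace (EuclideanSpace ℝ (Fin n)) M] [IsManifold (𝓡 n) (⊤ : ℕ∞) M] [T2Space M]
    [SecondCountableTopology M]
    (S : Set M) (hS : IsClosed S) (I : Ideal (Smooth n M)) (hI : I = vanishingIdeal S)
    (F : LieSubalgebra ℝ (Der ℝ (Smooth n M))) (hF : ∀ ξ ∈ F, ξ ∈ derW I)
    (p : ℕ) (ω : Form ℝ (Smooth n M) (p + 2)) (hω : ceDiff ω = 0)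
    (hωF : ∀ ξ ∈ F, ∀ v : Fin (p + 1) → Der ℝ (Smooth n M), (∀ i, v i ∈ derW I) →
      ω (Matrix.vecCons ξ v) ∈ I) :
    let 𝓕 : Submodule (Smooth n M) (Der ℝ (Smooth n M)) :=
      Submodule.span (Smooth n M) (F : Set (Der ℝ (Smooth n M))) ⊔ I • ⊤
    symLR I (F : Set (Der ℝ (Smooth n M))) = 𝓕 ∧
    (∃ Λ : LInfinityAlgebra ℝ (hamGrade ω),
      ∀ (j : ℕ) (x : Fin j → ham ω), (Λ.l j x : Amb ℝ (Smooth n M) p) =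
        obsBracket ω j fun i => (x i : Amb ℝ (Smooth n M) p)) ∧
    hamN I (F : Set (Der ℝ (Smooth n M))) ω ≤ hamW I (F : Set (Der ℝ (Smooth n M))) ω ∧
    (∃ Λ : LInfinityAlgebra ℝ (redGrade I (F : Set (Der ℝ (Smooth n M))) ω),
      ∀ (j : ℕ) (x : Fin j → hamW I (F : Set (Der ℝ (Smooth n M))) ω),
        ∃ h : obsBracket ω j (fun i => (x i : Amb ℝ (Smooth n M) p)) ∈
            hamW I (F : Set (Der ℝ (Smooth n M))) ω,
          Λ.l j (fun i => Submodule.Quotient.mk (x i)) = Submodule.Quotient.mk ⟨_, h⟩) ∧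
    (∀ x : Amb ℝ (Smooth n M) p, x ∈ hamW I (F : Set (Der ℝ (Smooth n M))) ω ↔
      (∀ m : Fin (p + 1), ∀ ξ ∈ F,
        contr ξ (x.1 m) ∈ formN I (m - 1 : ℕ) ∧ lieDer ξ (x.1 m) ∈ formN I m) ∧
      (contr x.2 ω : Form ℝ (Smooth n M) (p + 1)) = -ceDiff (x.1 (Fin.last p)) ∧
      x.2 ∈ derW I ∧
      ∀ ξ ∈ F, ⁅ξ, x.2⁆ ∈ 𝓕) ∧
    (∀ x : Amb ℝ (Smooth n M) p, x ∈ hamN I (F : Set (Der ℝ (Smooth n M))) ω ↔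
      (∀ m : Fin (p + 1), x.1 m ∈ formN I m) ∧
      (contr x.2 ω : Form ℝ (Smooth n M) (p + 1)) = -ceDiff (x.1 (Fin.last p)) ∧
      x.2 ∈ 𝓕) := by
  subst hI
  -- The only point where the geometry of `M` enters.
  have hN := derN_le_smul_top (n := n) (M := M) (vanishingIdeal S)
  have hsym := symLR_eq_spanLR hF hN
  have hωW := mem_basicW_of_closed hF hN hω hωF
  refine ⟨hsym, ⟨obsLInfinity hω (ham ω) le_rfl (fun i x hx => ambProj_mem_ham i hx)
    (fun _ _ hx => obsBracket_mem_ham hω hx), fun j x => obsLInfinity_l hω _ _ _ _ j x⟩,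
    hamN_le_hamW hF hN ω,
    exists_quotient_lInfinity hω _ _ (fun x hx => (mem_hamW_iff.1 hx).1)
      (fun i x hx => ambProj_mem_hamW i hx) (fun _ _ hx => obsBracket_mem_hamW hN hω hωW hx)
      (fun i x hx => ambProj_mem_hamN i hx)
      fun _ _ hx ⟨_, hi⟩ => obsBracket_mem_hamN hN hω hωW hx hi, fun x => ?_, fun x => ?_⟩
  · rw [mem_hamW_iff, mem_normW_symLR_iff hF hN]
    simp only [mem_basicW_symLR_iff hF hN]
    constructor
    · exact fun ⟨h1, h2, h3, h4⟩ => ⟨h2, h1, h3, h4⟩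
    · exact fun ⟨h2, h1, h3, h4⟩ => ⟨h1, h2, h3, h4⟩
  · rw [mem_hamN_iff, hsym]
    constructor
    · exact fun ⟨h1, h2, h3⟩ => ⟨h2, h1, h3⟩
    · exact fun ⟨h2, h1, h3⟩ => ⟨h1, h2, h3⟩
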